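/- Let $\mathrm C$ be a small category. A crossed monoid over $\mathrm C$ is a contravariant functor $A$ from $\mathrm C$ to monoids (for $\alpha\in \mathrm C(s,t)$ and $a\in A(t)$ write $a^\alpha=A(\alpha)(a)\in A(s)$), together with monoid homomorphisms $\partial_t\colon A(t)\to \mathrm C(t,t)$ for all objects $t$, such that $\alpha\,\partial_s(a^\alpha)=\partial_t(a)\,\alpha$ and $ab=b\,a^{\partial_t b}$ for all $\alpha\in \mathrm C(s,t)$, $a,b\in A(t)$. It is a crossed module if $\mathrm C$ is a groupoid and every $A(t)$ is a group. The nerve $N=N(A,\mathrm C)$ is the following simplicial set. $N_0$ is the set of objects of $\mathrm C$. For $n\ge1$, $N_n$ is the set of upper triangular $n\times n$ matrices $M=(m_{ij})_{i\le j}$ such that, for some objects $x_0,\dots,x_n$, $m_{jj}\in \mathrm C(x_j,x_{j-1})$ and $m_{ij}\in A(x_i)$ for $i<j$. On $N_1$, $d_0$ is the source and $d_1$ the target. For $n\ge2$, $d_0$ deletes the first row, $d_n$ deletes the last column, and for $1\le j\le n-1$ the face $d_j$ multiplies the entries in columns $j$ and $j+1$ of every row above the $j$-th, and replaces rows $j$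 and $j+1$ by the single row $$\bigl(m_{jj}\,\partial(m_{j,j+1})\,m_{j+1,j+1},\ m_{j,j+2}^{\eta_{j+1}}m_{j+1,j+2},\ \dots,\ m_{j,n}^{\eta_{n-1}}m_{j+1,n}\bigr),\qquad \eta_k=m_{j+1,j+1}\,\partial(m_{j+1,j+2}\cdots m_{j+1,k}).$$ The degeneracy $s_j$ inserts unit elements as a new $(j+1)$-st column in the first $j$ rows and a new $(j+1)$-st row $(1_{x_j},e,\dots,e)$, where $e$ is the unit of $A(x_j)$. For a simplicial set $X$ and $n\ge1$ let $\bigwedge^nX$ be the set of tuples $(y_0,\dots,y_n)$ in $X_{n-1}$ with $d_jy_k=d_{k-1}y_j$ for all $0\le j<k\le n$ (no condition if $n=1$), and let $b_n\colon X_n\to\bigwedge^nX$, $b_n(y)=(d_0y,\dots,d_ny)$. For $0\le l\le n$ let $\bigwedge^n_lX$ be the set of tuples $(y_0,\dots,\widehat{y_l},\dots,y_n)$ in $X_{n-1}$ satisfying these equations for $j,k\ne l$, and let $b^n_l\colon X_n\to\bigwedge^n_lX$, $b^n_l(y)=(d_0y,\dots,\widehat{d_ly},\dots,d_ny)$. $X$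 is a Kan complex if $b^n_l$ is surjective for all $n\ge1$ and $0\le l\le n$. Let $(A,\mathrm C)$ be a crossed module and $N=N(A,\mathrm C)$. Then: 1. An element $(M^0,M^1,M^2,M^3)\in\bigwedge^3N$, $M^i=(m^i_{jk})$, lies in the image of $b_3$ if and only if $(m^3_{12})^{m^3_{22}}\,m^1_{12}=(m^2_{12})^{m^3_{22}}\,m^0_{12}$. 2. $b^3_j\colon N_3\to\bigwedge^3_jN$ is surjective for $0\le j\le3$. 3. $b^4_j\colon N_4\to\bigwedge^4_jN$ is surjective for $0\le j\le4$. 4. $b_n\colon N_n\to\bigwedge^nN$ is bijective for every $n\ge4$. 5. $N$ is a Kan complex. -/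

import Mathlib

open CategoryTheory Opposite

universe v u w

/-- A simplicial set, given by face maps `d i : X (n + 1) → X n` and degeneracy maps
`s i : X n → X (n + 1)` subject to the simplicial identities. -/
structure SimplicialSet where
  X : ℕ → Type w
  d : ∀ {n : ℕ}, Fin (n + 2) → X (n + 1) → X n
  s : ∀ {n : ℕ}, Fin (n + 1) → X n → X (n + 1)
  d_d : ∀ {n : ℕ} (j k : Fin (n + 2)) (x : X (n + 2)), j ≤ k →
    d j (d k.succ x) = d k (d j.castSucc x)
  d_s_lt : ∀ {n : ℕ} (j : Fin (n + 2)) (k : Fin (n + 1)) (x : X (n + 1)), j ≤ k.castSucc →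
    d j.castSucc (s k.succ x) = s k (d j x)
  d_s_self : ∀ {n : ℕ} (j : Fin (n + 1)) (x : X n), d j.castSucc (s j x) = x
  d_s_succ : ∀ {n : ℕ} (j : Fin (n + 1)) (x : X n), d j.succ (s j x) = x
  d_s_gt : ∀ {n : ℕ} (k : Fin (n + 2)) (j : Fin (n + 1)) (x : X (n + 1)), j.castSucc < k →
    d k.succ (s j.castSucc x) = s j (d k x)
  s_s : ∀ {n : ℕ} (j k : Fin (n + 1)) (x : X n), j ≤ k →
    s j.castSucc (s k x) = s k.succ (s j x)

namespace SimplicialSet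

variable (S : SimplicialSet.{w})

/-- The compatibility condition that defines `⋀ⁿ⁺¹ S`: `dⱼ xₖ = dₖ₋₁ xⱼ` for all
`0 ≤ j < k ≤ n + 1` (with `j` and `k` written as `j.castSucc` and `k.succ`). There is no condition on
a pair of vertices. -/
def IsBoundary : {n : ℕ} → (Fin (n + 2) → S.X n) → Prop
  | 0, _ => True
  | n + 1, x => ∀ j k : Fin (n + 2), j ≤ k → S.d j (x k.succ) = S.d k (x j.castSucc)

/-- The set `⋀ⁿ⁺¹ S`. -/
def Boundary (n : ℕ) : Type w := {x : Fin (n + 2) → S.X n // S.IsBoundary x}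

/-- The boundary map `bₙ₊₁ : Sₙ₊₁ → ⋀ⁿ⁺¹ S`. -/
def boundaryMap (n : ℕ) (y : S.X (n + 1)) : S.Boundary n :=
  ⟨fun i => S.d i y, by
    cases n with
    | zero => trivial
    | succ n => exact fun j k h => S.d_d j k y h⟩

/-- The compatibility condition that defines the `l`-horns in dimension `n + 1`: `dⱼ xₖ = dₖ₋₁ xⱼ`
for all `0 ≤ j < k ≤ n + 1` different from `l`. -/
def IsHorn : {n : ℕ} → (l : Fin (n + 2)) → ({i : Fin (n + 2) // i ≠ l} → S.X n) → Prop
  | 0, _, _ => True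
  | n + 1, l, x => ∀ (j k : Fin (n + 2)) (hj : j.castSucc ≠ l) (hk : k.succ ≠ l), j ≤ k →
      S.d j (x ⟨k.succ, hk⟩) = S.d k (x ⟨j.castSucc, hj⟩)

/-- The set `⋀ⁿ⁺¹ₗ S` of `l`-horns in dimension `n + 1`. -/
def Horn (n : ℕ) (l : Fin (n + 2)) : Type w :=
  {x : {i : Fin (n + 2) // i ≠ l} → S.X n // S.IsHorn l x}

/-- The map `bⁿ⁺¹ₗ : Sₙ₊₁ → ⋀ⁿ⁺¹ₗ S`. -/
def hornMap (n : ℕ) (l : Fin (n + 2)) (y : S.X (n + 1)) : S.Horn n l :=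
  ⟨fun i => S.d i.1 y, by
    cases n with
    | zero => trivial
    | succ n => exact fun j k _ _ h => S.d_d j k y h⟩

/-- Kan complexes: every horn, in every dimension `n + 1 ≥ 1`, has a filler. -/
def IsKan : Prop := ∀ (n : ℕ) (l : Fin (n + 2)), Function.Surjective (S.hornMap n l)

end SimplicialSet

/-- A crossed monoid over `C`: a contravariant functor `A` from `C` to monoids together with
monoid homomorphisms `∂ t : A(t) → C(t, t)`. In `End t` the product is composition of functions,
`f * g = g ≫ f`; the composite written `α β` on paper is `β ≫ α` here. -/
structure CrossedMonoid (C : Type u) [Category.{v} C] where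
  A : Cᵒᵖ ⥤ MonCat.{w}
  bd : ∀ t : C, A.obj (op t) →* End t
  /-- `α ∂(a ^ α) = ∂(a) α` -/
  bd_act : ∀ {s t : C} (α : s ⟶ t) (a : A.obj (op t)),
    (bd s ((A.map α.op).hom a) : s ⟶ s) ≫ α = α ≫ (bd t a : t ⟶ t)
  /-- `a b = b a ^ ∂(b)` -/
  mul_eq : ∀ {t : C} (a b : A.obj (op t)),
    a * b = b * (A.map (bd t b : t ⟶ t).op).hom a

namespace CrossedMonoid

variable {C : Type u} [Category.{v} C] (P : CrossedMonoid.{v, u, w} C)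

/-- The monoid `A(x)`. -/
abbrev M (x : C) : Type w := P.A.obj (op x)

/-- The action `a ^ α` of a morphism `α : s ⟶ t` on `a ∈ A(t)`. -/
def act {s t : C} (α : s ⟶ t) : P.M t →* P.M s := (P.A.map α.op).hom

/-- `∂(a)` as a morphism of `C`. -/
def del {t : C} (a : P.M t) : t ⟶ t := P.bd t a

/-- Crossed modules: `C` is a groupoid and every `A(t)` is a group. -/
structure IsCrossedModule : Prop where
  isIso : ∀ {s t : C} (α : s ⟶ t), IsIso α
  isUnit : ∀ {t : C} (a : P.M t), IsUnit a

/-- `Tri P n x` is the set of `n × n` upper triangular matrices with `x₀ = x`, built row by row.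
The matrix `cons m a T` has first row `(m, a 0, a 1, …)`, with `m : x₁ ⟶ x₀` and all `a i ∈ A(x₁)`;
the other rows form the upper triangular matrix `T`, whose sequence of objects starts with `x₁`. -/
inductive Tri : ℕ → C → Type max u v w
  | nil (x : C) : Tri 0 x
  | cons {n : ℕ} {x y : C} (m : y ⟶ x) (a : Fin n → P.M y) (T : Tri n y) : Tri (n + 1) x

variable {P}

/-- The matrix `d₁` of `cons m a T` for a matrix with at least two rows: with first rows
`(m₁₁, m₁₂, …)` and `(m₂₂, m₂₃, …)` the new first row consists of `m₁₁ ∂(m₁₂) m₂₂` and of the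
elements `m₁ₖ ^ η * m₂ₖ`, `3 ≤ k`, where `η = m₂₂ ∂(m₂₃ ⋯ m₂,ₖ₋₁)`. -/
def Tri.merge {n : ℕ} {x y : C} (m : y ⟶ x) (a : Fin (n + 1) → P.M y) :
    Tri P (n + 1) y → Tri P (n + 1) x
  | .cons m' a' T =>
    .cons (m' ≫ P.del (a 0) ≫ m)
      (fun i => P.act (P.del (Fin.partialProd a' i.castSucc) ≫ m') (a i.succ) * a' i) T

/-- The faces `d₁, …, dₙ₊₁` of an upper triangular matrix of size `n + 1`; `faceSucc k` is
`dₖ₊₁`. They do not change the object `x₀`. In the rows above the `j`-th row the face `dⱼ`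
multiplies the neighbouring elements in columns `j` and `j + 1`, or deletes the last element if `j`
is the size of the matrix. (`Fin.contractNth` does both.) -/
def Tri.faceSucc : {n : ℕ} → {x : C} → Fin (n + 1) → Tri P (n + 1) x → Tri P n x
  | 0, _, _, .cons _ _ _ => .nil _
  | _ + 1, _, k, .cons m a T =>
    Fin.cases (Tri.merge m a T)
      (fun k' => .cons m (Fin.contractNth k' (· * ·) a) (Tri.faceSucc k' T)) k

/-- The degeneracies of an upper triangular matrix: `s₀` puts the row `(1, e, …, e)` on top, and
`sⱼ` for `j > 0` inserts `e` in column `j + 1` of the first row, and acts as `sⱼ₋₁` on the matrix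
formed by the other rows. -/
def Tri.degen : {n : ℕ} → {x : C} → Fin (n + 1) → Tri P n x → Tri P (n + 1) x
  | _, x, ⟨0, _⟩, T => .cons (𝟙 x) (fun _ => 1) T
  | _ + 1, _, ⟨j + 1, h⟩, .cons m a T =>
    .cons m (Fin.insertNth (α := fun _ => P.M _) ⟨j, Nat.lt_of_succ_lt_succ h⟩ 1 a)
      (Tri.degen ⟨j, Nat.lt_of_succ_lt_succ h⟩ T)

theorem Tri.faceSucc_zero {n : ℕ} {x y : C} (m : y ⟶ x) (a : Fin (n + 1) → P.M y)
    (T : Tri P (n + 1) y) : Tri.faceSucc 0 (.cons m a T) = Tri.merge m a T := rfl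

theorem Tri.faceSucc_succ {n : ℕ} {x y : C} (k : Fin (n + 1)) (m : y ⟶ x)
    (a : Fin (n + 1) → P.M y) (T : Tri P (n + 1) y) :
    Tri.faceSucc k.succ (.cons m a T) =
      .cons m (Fin.contractNth k (· * ·) a) (Tri.faceSucc k T) := rfl

theorem Tri.degen_zero {n : ℕ} {x : C} (T : Tri P n x) :
    Tri.degen 0 T = .cons (𝟙 x) (fun _ => 1) T := by
  cases T <;> rfl

theorem Tri.degen_succ {n : ℕ} {x y : C} (j : Fin (n + 1)) (m : y ⟶ x) (a : Fin n → P.M y)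
    (T : Tri P n y) :
    Tri.degen j.succ (.cons m a T) =
      .cons m (Fin.insertNth (α := fun _ => P.M _) j 1 a) (Tri.degen j T) := by
  cases j; rfl

theorem act_act {r s t : C} (β : r ⟶ s) (α : s ⟶ t) (a : P.M t) :
    P.act β (P.act α a) = P.act (β ≫ α) a := by simp [act]

theorem act_id {t : C} (a : P.M t) : P.act (𝟙 t) a = a := by simp [act]

theorem del_one {t : C} : P.del (1 : P.M t) = 𝟙 t := by simp [del, End.one_def]

theorem del_mul {t : C} (a b : P.M t) : P.del (a * b) = P.del b ≫ P.del a := by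
  simp [del, End.mul_def]

theorem del_act {s t : C} (α : s ⟶ t) (a : P.M t) :
    P.del (P.act α a) ≫ α = α ≫ P.del a := P.bd_act α a

theorem mul_eq' {t : C} (a b : P.M t) : a * b = b * P.act (P.del b) a := P.mul_eq a b

section Rows

theorem insertNth_eq {α : Type w} {n : ℕ} (j : Fin (n + 1)) (e : α) (a : Fin n → α) (i : Fin (n + 1)) :
    Fin.insertNth (α := fun _ => α) j e a i =
      if h : i.1 < j.1 then a ⟨i.1, by omega⟩ else
        if h' : i.1 = j.1 then e else a ⟨i.1 - 1, by omega⟩ := by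
  rcases Fin.eq_self_or_eq_succAbove j i with rfl | ⟨i, rfl⟩
  · simp
  · rw [Fin.insertNth_apply_succAbove]
    rcases lt_or_ge i.castSucc j with h | h
    · rw [Fin.succAbove_of_castSucc_lt _ _ h]
      rw [dif_pos (by simpa [Fin.lt_def] using h)]
      rfl
    · rw [Fin.succAbove_of_le_castSucc _ _ h]
      simp only [Fin.le_def, Fin.val_castSucc] at h
      rw [dif_neg (by simp; omega), dif_neg (by simp; omega)]
      rfl

variable {α : Type w} [Monoid α]

theorem contractNth_contractNth {n : ℕ} (j k : Fin (n + 1)) (h : j ≤ k) (a : Fin (n + 2) → α) :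
    Fin.contractNth j (· * ·) (Fin.contractNth k.succ (· * ·) a) =
      Fin.contractNth k (· * ·) (Fin.contractNth j.castSucc (· * ·) a) := by
  rcases j with ⟨j, hj⟩
  rcases k with ⟨k, hk⟩
  ext ⟨i, hi⟩
  simp only [Fin.le_def] at h
  simp only [Fin.contractNth, Fin.succ_mk, Fin.castSucc_mk]
  split_ifs <;> first | rfl | omega | simp only [mul_assoc]

theorem contractNth_insertNth_of_lt {n : ℕ} (j k : Fin (n + 1)) (a : Fin (n + 1) → α)
    (h : j < k) :
    Fin.contractNth j.castSucc (· * ·) (Fin.insertNth (α := fun _ => α) k.succ 1 a) =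
      Fin.insertNth (α := fun _ => α) k 1 (Fin.contractNth j (· * ·) a) := by
  rcases j with ⟨j, hj⟩
  rcases k with ⟨k, hk⟩
  simp only [Fin.lt_def] at h
  ext ⟨i, hi⟩
  simp only [Fin.contractNth, insertNth_eq, Fin.succ_mk, Fin.castSucc_mk]
  split_ifs <;> first | omega | rfl | (congr 2; omega)

theorem contractNth_insertNth_self {n : ℕ} (j : Fin n) (a : Fin n → α) :
    Fin.contractNth j.castSucc (· * ·) (Fin.insertNth (α := fun _ => α) j.succ 1 a) = a := by
  rcases j with ⟨j, hj⟩
  ext ⟨i, hi⟩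
  simp only [Fin.contractNth, insertNth_eq, Fin.succ_mk, Fin.castSucc_mk]
  split_ifs <;> first | omega | rfl | simp

theorem contractNth_insertNth_succ {n : ℕ} (j : Fin (n + 1)) (a : Fin n → α) :
    Fin.contractNth j (· * ·) (Fin.insertNth (α := fun _ => α) j 1 a) = a := by
  rcases j with ⟨j, hj⟩
  ext ⟨i, hi⟩
  simp only [Fin.contractNth, insertNth_eq, Fin.succ_mk, Fin.castSucc_mk]
  split_ifs <;> first | omega | rfl | simp

theorem contractNth_insertNth_of_gt {n : ℕ} (j k : Fin (n + 1)) (a : Fin (n + 1) → α)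
    (h : j ≤ k) :
    Fin.contractNth k.succ (· * ·) (Fin.insertNth (α := fun _ => α) j.castSucc 1 a) =
      Fin.insertNth (α := fun _ => α) j 1 (Fin.contractNth k (· * ·) a) := by
  rcases j with ⟨j, hj⟩
  rcases k with ⟨k, hk⟩
  simp only [Fin.le_def] at h
  ext ⟨i, hi⟩
  simp only [Fin.contractNth, insertNth_eq, Fin.succ_mk, Fin.castSucc_mk]
  split_ifs <;> first | omega | rfl | (congr 2; omega) | (congr 3; omega)

theorem insertNth_insertNth {n : ℕ} (j k : Fin (n + 1)) (a : Fin n → α) (h : j ≤ k) :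
    Fin.insertNth (α := fun _ => α) j.castSucc 1 (Fin.insertNth (α := fun _ => α) k 1 a) =
      Fin.insertNth (α := fun _ => α) k.succ 1 (Fin.insertNth (α := fun _ => α) j 1 a) := by
  rcases j with ⟨j, hj⟩
  rcases k with ⟨k, hk⟩
  simp only [Fin.le_def] at h
  ext ⟨i, hi⟩
  simp only [insertNth_eq, Fin.succ_mk, Fin.castSucc_mk]
  split_ifs <;> first | omega | rfl

theorem partialProd_insertNth {n : ℕ} (k : Fin (n + 1)) (a : Fin n → α) (i : Fin n) :
    Fin.partialProd (Fin.insertNth (α := fun _ => α) k 1 a) (k.succAbove i).castSucc =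
      Fin.partialProd a i.castSucc := by
  have h := congrFun (Fin.partialProd_contractNth (Fin.insertNth (α := fun _ => α) k 1 a) k)
    i.castSucc
  rw [contractNth_insertNth_succ, Function.comp_apply] at h
  rw [h]
  rcases lt_trichotomy i.1 k.1 with hi | hi | hi
  · congr 1
    rw [Fin.succAbove_of_castSucc_lt _ _ (by simpa [Fin.lt_def] using hi),
      Fin.succAbove_of_castSucc_lt _ _ (by simp [Fin.lt_def]; omega)]
  · have hk : k = i.castSucc := Fin.ext hi.symm
    subst hk
    rw [Fin.succAbove_of_castSucc_lt i.castSucc.succ _ (by simp [Fin.lt_def]),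
      Fin.succAbove_of_le_castSucc i.castSucc _ le_rfl, ← Fin.succ_castSucc,
      Fin.partialProd_succ]
    simp
  · congr 1
    rw [Fin.succAbove_of_le_castSucc _ _ (by simp [Fin.le_def]; omega),
      Fin.succAbove_of_le_castSucc _ _ (by simp [Fin.le_def]; omega)]
    rfl

end Rows

theorem partialProd_merge {n : ℕ} {y z : C} (m : z ⟶ y) (b : Fin n → P.M y) (c : Fin n → P.M z)
    (i : Fin (n + 1)) :
    Fin.partialProd (fun i => P.act (P.del (Fin.partialProd c i.castSucc) ≫ m) (b i) * c i) i =
      P.act m (Fin.partialProd b i) * Fin.partialProd c i := by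
  induction i using Fin.induction with
  | zero => simp
  | succ i ih =>
    rw [Fin.partialProd_succ, Fin.partialProd_succ, Fin.partialProd_succ, ih, map_mul,
      mul_assoc, mul_assoc, ← mul_assoc (Fin.partialProd c i.castSucc), ← act_act, ← mul_eq']
    simp only [mul_assoc]

theorem Tri.faceSucc_faceSucc {n : ℕ} {x : C} (j k : Fin (n + 1)) (h : j ≤ k)
    (T : Tri P (n + 2) x) :
    Tri.faceSucc j (Tri.faceSucc k.succ T) = Tri.faceSucc k (Tri.faceSucc j.castSucc T) := by
  induction n generalizing x with
  | zero =>
    cases Tri.faceSucc j (Tri.faceSucc k.succ T)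
    cases Tri.faceSucc k (Tri.faceSucc j.castSucc T)
    rfl
  | succ n ih =>
    cases T with
    | cons m a T =>
    induction k using Fin.cases with
    | zero =>
      obtain rfl : j = 0 := by simpa using h
      cases T with
      | cons m' a' T =>
      cases T with
      | cons m'' a'' T =>
      rw [Fin.castSucc_zero, faceSucc_succ, faceSucc_zero, faceSucc_zero, faceSucc_zero]
      simp only [merge, faceSucc_zero]
      congr 1
      · simp only [Fin.contractNth, Fin.val_zero, lt_irrefl, if_true, if_false, del_mul,
          Fin.castSucc_zero, Fin.partialProd_zero, del_one, Category.id_comp, Category.assoc]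
        rw [← Category.assoc (P.del (P.act m' _)), del_act]
        simp only [Category.assoc]
      · funext i
        rw [partialProd_merge m'' (fun i => a' i.succ) a'']
        have e : Fin.contractNth 0 (· * ·) a i.succ = a i.succ.succ := by
          simp [Fin.contractNth]
        simp only [e, map_mul, act_act, ← mul_assoc, ← Fin.succ_castSucc, Fin.partialProd_succ',
          del_mul, Category.assoc, Fin.tail_def]
        congr 4
        rw [← Category.assoc (P.del (P.act m'' _)), del_act]
        simp only [Category.assoc]
    | succ k =>
      induction j using Fin.cases with
      | zero =>
        cases T with
        | cons m' a' T =>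
        rw [Fin.castSucc_zero, faceSucc_succ, faceSucc_succ, faceSucc_zero, faceSucc_zero]
        simp only [merge, faceSucc_succ]
        congr 1
        funext i
        rw [Fin.partialProd_contractNth, Function.comp_apply]
        rcases lt_trichotomy i.1 k.1 with hi | hi | hi
        · rw [Fin.contractNth_apply_of_lt _ _ _ _ hi, Fin.contractNth_apply_of_lt _ _ _ _ hi,
            Fin.contractNth_apply_of_lt _ _ _ _ (by simpa using hi),
            Fin.succAbove_of_castSucc_lt _ _ (by simp [Fin.lt_def]; omega), Fin.succ_castSucc]
        · rw [Fin.contractNth_apply_of_eq _ _ _ _ hi, Fin.contractNth_apply_of_eq _ _ _ _ hi,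
            Fin.contractNth_apply_of_eq _ _ _ _ (by simpa using hi),
            Fin.succAbove_of_castSucc_lt _ _ (by simp [Fin.lt_def]; omega), Fin.succ_castSucc,
            ← Fin.succ_castSucc i, Fin.partialProd_succ, del_mul, Category.assoc,
            ← act_act _ _ (a i.succ.succ), map_mul]
          simp only [mul_assoc]
          rw [← mul_assoc (a' i.castSucc), ← mul_eq']
          simp only [mul_assoc]
        · rw [Fin.contractNth_apply_of_gt _ _ _ _ hi, Fin.contractNth_apply_of_gt _ _ _ _ hi,
            Fin.contractNth_apply_of_gt _ _ _ _ (by simpa using hi),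
            Fin.succAbove_of_le_castSucc _ _ (by simp [Fin.le_def]; omega)]
          rfl
      | succ j =>
        rw [← Fin.succ_castSucc, faceSucc_succ, faceSucc_succ, faceSucc_succ, faceSucc_succ,
          contractNth_contractNth _ _ (by simpa using h), ih _ _ (by simpa using h)]

theorem Tri.merge_degen {n : ℕ} {x y : C} (k : Fin (n + 1)) (m : y ⟶ x)
    (a : Fin (n + 1) → P.M y) (T : Tri P (n + 1) y) :
    Tri.merge m (Fin.insertNth (α := fun _ => P.M _) k.succ 1 a) (Tri.degen k.succ T) =
      Tri.degen k.succ (Tri.merge m a T) := by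
  cases T with
  | cons m' a' T =>
  rw [degen_succ]
  simp only [merge, degen_succ]
  have e : ∀ i, Fin.insertNth (α := fun _ => P.M y) k.succ 1 a (Fin.succ i) =
      Fin.insertNth (α := fun _ => P.M y) k 1 (fun i => a i.succ) i := by
    intro i
    rcases Fin.eq_self_or_eq_succAbove k i with rfl | ⟨i, rfl⟩
    · simp
    · rw [← Fin.succ_succAbove_succ]
      simp only [Fin.insertNth_apply_succAbove]
  congr 1
  funext i
  rw [e]
  rcases Fin.eq_self_or_eq_succAbove k i with rfl | ⟨i, rfl⟩
  · simp
  · simp only [Fin.insertNth_apply_succAbove, partialProd_insertNth]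

theorem Tri.faceSucc_degen_lt {n : ℕ} {x : C} (j : Fin (n + 2)) (k : Fin (n + 1))
    (h : j ≤ k.castSucc) (T : Tri P (n + 2) x) :
    Tri.faceSucc j.castSucc (Tri.degen k.succ.succ T) =
      Tri.degen k.succ (Tri.faceSucc j T) := by
  induction n generalizing x with
  | zero =>
    obtain rfl : k = 0 := Subsingleton.elim (α := Fin 1) _ _
    obtain rfl : j = 0 := by simpa using h
    cases T with
    | cons m a T =>
    rw [Fin.castSucc_zero, degen_succ, faceSucc_zero, faceSucc_zero, merge_degen]
  | succ n ih =>
    cases T with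
    | cons m a T =>
    induction j using Fin.cases with
    | zero => rw [Fin.castSucc_zero, degen_succ, faceSucc_zero, faceSucc_zero, merge_degen]
    | succ j =>
      induction k using Fin.cases with
      | zero => simp at h
      | succ k =>
        have h' : j ≤ k.castSucc := by simpa [Fin.le_def] using h
        rw [← Fin.succ_castSucc, degen_succ, faceSucc_succ, faceSucc_succ, degen_succ, ih _ _ h',
          contractNth_insertNth_of_lt]
        simp only [Fin.le_def, Fin.lt_def, Fin.val_castSucc, Fin.val_succ] at h' ⊢
        omega

theorem Tri.faceSucc_degen_self {n : ℕ} {x : C} (j : Fin (n + 1)) (T : Tri P (n + 1) x) :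
    Tri.faceSucc j.castSucc (Tri.degen j.succ T) = T := by
  induction n generalizing x with
  | zero =>
    obtain rfl : j = 0 := Subsingleton.elim (α := Fin 1) _ _
    cases T with
    | cons m a T =>
    rw [Fin.castSucc_zero, degen_succ, faceSucc_zero, degen_zero]
    simp only [merge]
    congr 1
    · simp [del_one]
    · funext i
      exact i.elim0
  | succ n ih =>
    cases T with
    | @cons _ _ y m a T =>
    induction j using Fin.cases with
    | zero =>
      rw [Fin.castSucc_zero, degen_succ, faceSucc_zero, degen_zero]
      simp only [merge]
      congr 1
      · simp [del_one]
      · funext i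
        have e : Fin.partialProd (fun _ : Fin (n + 1) => (1 : P.M y)) i.castSucc = 1 := by
          induction i using Fin.induction with
          | zero => simp
          | succ i ih => rw [← Fin.succ_castSucc, Fin.partialProd_succ, ih, mul_one]
        simp [e, del_one, act_id]
    | succ j =>
      rw [← Fin.succ_castSucc, degen_succ, faceSucc_succ, ih, contractNth_insertNth_self]

theorem Tri.faceSucc_degen_succ {n : ℕ} {x : C} (j : Fin (n + 1)) (T : Tri P n x) :
    Tri.faceSucc j (Tri.degen j T) = T := by
  induction n generalizing x with
  | zero =>
    cases Tri.faceSucc j (Tri.degen j T)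
    cases T
    rfl
  | succ n ih =>
    cases T with
    | cons m a T =>
    induction j using Fin.cases with
    | zero =>
      rw [degen_zero, faceSucc_zero]
      simp [merge, del_one]
    | succ j => rw [degen_succ, faceSucc_succ, ih, contractNth_insertNth_succ]

theorem Tri.faceSucc_degen_gt {n : ℕ} {x : C} (j k : Fin (n + 1)) (h : j ≤ k)
    (T : Tri P (n + 1) x) :
    Tri.faceSucc k.succ (Tri.degen j.castSucc T) = Tri.degen j (Tri.faceSucc k T) := by
  induction n generalizing x with
  | zero =>
    obtain rfl : j = 0 := Subsingleton.elim (α := Fin 1) _ _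
    rw [Fin.castSucc_zero, degen_zero, degen_zero, faceSucc_succ]
    congr 1
    funext i
    exact i.elim0
  | succ n ih =>
    induction j using Fin.cases with
    | zero =>
      rw [Fin.castSucc_zero, degen_zero, degen_zero, faceSucc_succ]
      congr 1
      funext i
      simp [Fin.contractNth]
    | succ j =>
      induction k using Fin.cases with
      | zero => simp at h
      | succ k =>
        cases T with
        | cons m a T =>
        rw [← Fin.succ_castSucc, degen_succ, faceSucc_succ, faceSucc_succ, degen_succ,
          ih _ _ (by simpa using h), contractNth_insertNth_of_gt _ _ _ (by simpa using h)]

theorem Tri.degen_degen {n : ℕ} {x : C} (j k : Fin (n + 1)) (h : j ≤ k) (T : Tri P n x) :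
    Tri.degen j.castSucc (Tri.degen k T) = Tri.degen k.succ (Tri.degen j T) := by
  induction n generalizing x with
  | zero =>
    obtain rfl : j = 0 := Subsingleton.elim (α := Fin 1) _ _
    obtain rfl : k = 0 := Subsingleton.elim (α := Fin 1) _ _
    rw [Fin.castSucc_zero, degen_zero, degen_zero, degen_succ, degen_zero]
    congr 1
    funext i
    have hi : i = 0 := Subsingleton.elim (α := Fin 1) _ _
    simp [hi]
  | succ n ih =>
    induction j using Fin.cases with
    | zero =>
      rw [Fin.castSucc_zero, degen_zero, degen_zero, degen_succ]
      congr 1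
      funext i
      rcases Fin.eq_self_or_eq_succAbove k i with rfl | ⟨i, rfl⟩ <;> simp
    | succ j =>
      induction k using Fin.cases with
      | zero => simp at h
      | succ k =>
        cases T with
        | cons m a T =>
        rw [← Fin.succ_castSucc, degen_succ, degen_succ, degen_succ, degen_succ,
          ih _ _ (by simpa using h), insertNth_insertNth _ _ _ (by simpa using h)]

/-- `N_n(A, C)`: a matrix together with its object `x₀`. -/
def NerveObj (P : CrossedMonoid.{v, u, w} C) (n : ℕ) : Type max u v w := Σ x : C, Tri P n x

/-- `d₀` deletes the first row. -/
def NerveObj.faceZero {n : ℕ} : NerveObj P (n + 1) → NerveObj P n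
  | ⟨_, .cons (y := y) _ _ T⟩ => ⟨y, T⟩

def NerveObj.face {n : ℕ} (j : Fin (n + 2)) (x : NerveObj P (n + 1)) : NerveObj P n :=
  Fin.cases x.faceZero (fun k => ⟨x.1, Tri.faceSucc k x.2⟩) j

def NerveObj.degen {n : ℕ} (j : Fin (n + 1)) (x : NerveObj P n) : NerveObj P (n + 1) :=
  ⟨x.1, Tri.degen j x.2⟩

/-- The nerve `N(A, C)`. -/
def nerve (P : CrossedMonoid.{v, u, w} C) : SimplicialSet.{max u v w} where
  X := NerveObj P
  d := NerveObj.face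
  s := NerveObj.degen
  d_d j k x h := by
    obtain ⟨x, T⟩ := x
    cases T with
    | cons m a T =>
    induction k using Fin.cases with
    | zero =>
      obtain rfl : j = 0 := by simpa using h
      cases T with
      | cons m' a' T => rfl
    | succ k =>
      induction j using Fin.cases with
      | zero => rfl
      | succ j =>
        exact congrArg (Sigma.mk x) (Tri.faceSucc_faceSucc j k (by simpa using h) (.cons m a T))
  d_s_lt {n} j k x h := by
    obtain ⟨x, T⟩ := x
    induction j using Fin.cases with
    | zero =>
      cases T with
      | cons m a T =>
        exact congrArg NerveObj.faceZero (congrArg (Sigma.mk x) (Tri.degen_succ k m a T))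
    | succ j =>
      cases n with
      | zero =>
        have hk := k.2
        have h' : j.1 + 1 ≤ k.1 := h
        omega
      | succ n =>
      induction k using Fin.cases with
      | zero => simp at h
      | succ k =>
        exact congrArg (Sigma.mk x) (Tri.faceSucc_degen_lt j k (by simpa [Fin.le_def] using h) T)
  d_s_self {n} j x := by
    obtain ⟨x, T⟩ := x
    induction j using Fin.cases with
    | zero => exact congrArg NerveObj.faceZero (congrArg (Sigma.mk x) (Tri.degen_zero T))
    | succ j =>
      cases n with
      | zero => exact j.elim0
      | succ n => exact congrArg (Sigma.mk x) (Tri.faceSucc_degen_self j T)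
  d_s_succ j x := congrArg (Sigma.mk x.1) (Tri.faceSucc_degen_succ j x.2)
  d_s_gt k j x h := by
    induction k using Fin.cases with
    | zero => simp at h
    | succ k =>
      exact congrArg (Sigma.mk x.1) (Tri.faceSucc_degen_gt j k
        (Nat.lt_succ_iff.mp h) x.2)
  s_s j k x h := congrArg (Sigma.mk x.1) (Tri.degen_degen j k h x.2)

/-- For a `2 × 2` matrix `M` with rows `(m₁₁, m₁₂)` and `(m₂₂)`: the object `x₁`. -/
def NerveObj.x₁ : NerveObj P 2 → C
  | ⟨_, .cons (y := y) _ _ _⟩ => y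

/-- The object `x₂` of a `2 × 2` matrix. -/
def NerveObj.x₂ : NerveObj P 2 → C
  | ⟨_, .cons _ _ (.cons (y := z) _ _ _)⟩ => z

/-- The entry `m₁₂ ∈ A(x₁)` of a `2 × 2` matrix. -/
def NerveObj.m₁₂ : (M : NerveObj P 2) → P.M M.x₁
  | ⟨_, .cons _ a _⟩ => a 0

/-- The entry `m₂₂ ∈ C(x₂, x₁)` of a `2 × 2` matrix. -/
def NerveObj.m₂₂ : (M : NerveObj P 2) → (M.x₂ ⟶ M.x₁)
  | ⟨_, .cons _ _ (.cons m _ _)⟩ => m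

theorem NerveObj.d_two_x₁ (M : NerveObj P 2) :
    (NerveObj.faceZero (NerveObj.face 2 M)).1 = M.x₁ := by
  obtain ⟨_, _ | ⟨_, _, _ | _⟩⟩ := M
  rfl

theorem NerveObj.d_one_x₂ (M : NerveObj P 2) :
    (NerveObj.faceZero (NerveObj.face 1 M)).1 = M.x₂ := by
  obtain ⟨_, _ | ⟨_, _, _ | _⟩⟩ := M
  rfl

theorem NerveObj.d_zero_x₂ (M : NerveObj P 2) :
    (NerveObj.faceZero (NerveObj.face 0 M)).1 = M.x₂ := by
  obtain ⟨_, _ | ⟨_, _, _ | _⟩⟩ := M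
  rfl

/-- The `i`-th component `Mⁱ ∈ N₂(A, C)` of an element of `⋀³ N(A, C)`. -/
def comp (M : P.nerve.Boundary 2) (i : Fin 4) : NerveObj P 2 := M.1 i

theorem x₁_comp_zero (M : P.nerve.Boundary 2) : (comp M 0).x₁ = (comp M 3).x₂ := by
  rw [← NerveObj.d_two_x₁, ← NerveObj.d_zero_x₂]
  exact congrArg (fun e => (NerveObj.faceZero e).1) (M.2 0 2 (by decide)).symm

theorem x₁_comp_one (M : P.nerve.Boundary 2) : (comp M 1).x₁ = (comp M 3).x₂ := by
  rw [← NerveObj.d_two_x₁, ← NerveObj.d_one_x₂]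
  exact congrArg (fun e => (NerveObj.faceZero e).1) (M.2 1 2 (by decide)).symm

theorem x₁_comp_two (M : P.nerve.Boundary 2) : (comp M 2).x₁ = (comp M 3).x₁ := by
  rw [← NerveObj.d_two_x₁, ← NerveObj.d_two_x₁]
  exact congrArg (fun e => (NerveObj.faceZero e).1) (M.2 2 2 le_rfl).symm

/-- The identification of `A(x)` and `A(y)` if `x` and `y` are the same object. -/
def transport {x y : C} (h : x = y) (a : P.M x) : P.M y := h ▸ a

/-- The equation `(m³₁₂) ^ m³₂₂ * m¹₁₂ = (m²₁₂) ^ m³₂₂ * m⁰₁₂` in `A(x₂(M³))`, for an element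
`(M⁰, M¹, M², M³)` of `⋀³ N(A, C)`. -/
def ImageEquation (M : P.nerve.Boundary 2) : Prop :=
  P.act (comp M 3).m₂₂ (comp M 3).m₁₂ * transport (x₁_comp_one M) (comp M 1).m₁₂ =
    P.act (comp M 3).m₂₂ (transport (x₁_comp_two M) (comp M 2).m₁₂) *
      transport (x₁_comp_zero M) (comp M 0).m₁₂

end CrossedMonoid

/-! The proof rests on one observation. Deleting the first row of a matrix of size at least 3 leaves
all other rows in `d₀`, while `d₂` and the last face keep the corner entry and see the rest of the
first row `(m, a₀, a₁, …)` as `(a₀a₁, a₂, …)` and as the row without its last entry. In a group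
these two rows determine `a`, and any two such rows that agree where they overlap come from some
`a`. So the faces 0, 2 and last determine a simplex of dimension at least 3 (`facesDetermine_nerve`)
and can be prescribed subject only to their mutual compatibility (`facesFill_nerve`).

From dimension 4 on, the remaining faces of a simplex built from a boundary are correct because they
have dimension at least 3 and can be compared on their own faces 0, 2 and last. This gives
bijectivity of `bₙ`. A horn of dimension at least 5 is then filled in two steps: first its missing
face, whose boundary is known, and then the whole simplex.

In dimension 3 the entry `b = m₁₃` of a filler is forced by `a₃ b = a₂` (`aᵢ` being the off-diagonal
entry of the face `i`), and the face 1 then requires `a₁ = b ^ m' a₀` with `m' = m³₂₂`, which is the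
equation of the theorem. Each `aᵢ` occurs there exactly once and can be solved for, so horns of
dimension 3 have exactly one filler. This replaces the filling of boundaries when horns of dimension
4 are treated (`hornMap_three_surjective`). In dimensions 1 and 2 a degenerate edge and composition
in the groupoid suffice. -/

namespace SimplicialSet

/-! ### Filling boundaries and horns in a simplicial set controlled by the faces 0, 2 and last. -/

variable (S : SimplicialSet.{w})

/-- The faces `0`, `2` and the last face determine a simplex of dimension at least `3`. -/
def FacesDetermine : Prop := ∀ (k : ℕ) (M N : S.X (k + 3)), S.d 0 M = S.d 0 N →
  S.d 2 M = S.d 2 N → S.d (Fin.last _) M = S.d (Fin.last _) N → M = N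

/-- Compatible simplices are the faces `0`, `2` and last of a simplex of dimension at least `3`. -/
def FacesFill : Prop := ∀ (k : ℕ) (y₀ y₂ yₙ : S.X (k + 2)), S.d 0 y₂ = S.d 1 y₀ →
  S.d 0 yₙ = S.d (Fin.last _) y₀ → S.d 2 yₙ = S.d (Fin.last _) y₂ →
  ∃ M, S.d 0 M = y₀ ∧ S.d 2 M = y₂ ∧ S.d (Fin.last _) M = yₙ

variable {S}

theorem d_d_mk {n : ℕ} (j k : ℕ) (hk : k < n + 2) (h : j ≤ k) (x : S.X (n + 2)) :
    S.d ⟨j, h.trans_lt hk⟩ (S.d ⟨k + 1, by omega⟩ x) = S.d ⟨k, hk⟩ (S.d ⟨j, by omega⟩ x) :=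
  S.d_d ⟨j, h.trans_lt hk⟩ ⟨k, hk⟩ x h

theorem IsBoundary.mk {n : ℕ} {y : Fin (n + 3) → S.X (n + 1)} (hy : S.IsBoundary y) (j k : ℕ)
    (hk : k < n + 2) (h : j ≤ k) :
    S.d ⟨j, h.trans_lt hk⟩ (y ⟨k + 1, by omega⟩) = S.d ⟨k, hk⟩ (y ⟨j, by omega⟩) :=
  hy ⟨j, h.trans_lt hk⟩ ⟨k, hk⟩ h

theorem boundaryMap_injective (hE : S.FacesDetermine) (n : ℕ) :
    Function.Injective (S.boundaryMap (n + 3)) := by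
  intro M M' h
  have h' : ∀ i, S.d i M = S.d i M' := fun i => congrFun (congrArg Subtype.val h) i
  exact hE (n + 1) M M' (h' _) (h' _) (h' _)

theorem boundaryMap_surjective (hE : S.FacesDetermine) (hF : S.FacesFill) (n : ℕ) :
    Function.Surjective (S.boundaryMap (n + 3)) := by
  rintro ⟨y, hy⟩
  obtain ⟨M, h0, h2, hl⟩ := hF (n + 1) (y 0) (y 2) (y (Fin.last _))
    (hy.mk 0 1 (by omega) (by omega)) (hy.mk 0 (n + 3) (by omega) (by omega))
    (hy.mk 2 (n + 3) (by omega) (by omega))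
  -- The faces from 3 on come before the face 1, since `d₂ d₁ M = d₁ d₃ M` uses that the face 3 is
  -- already known.
  have key : ∀ j (hj : j < n + 4), 3 ≤ j → S.d ⟨j, by omega⟩ M = y ⟨j, by omega⟩ := by
    intro j hj h3
    obtain ⟨j, rfl⟩ : ∃ i, j = i + 1 := ⟨j - 1, by omega⟩
    refine hE n _ _ ?_ ?_ ?_
    · exact (d_d_mk 0 j (by omega) (by omega) M).trans
        ((congrArg _ h0).trans (hy.mk 0 j (by omega) (by omega)).symm)
    · exact (d_d_mk 2 j (by omega) (by omega) M).trans
        ((congrArg _ h2).trans (hy.mk 2 j (by omega) (by omega)).symm)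
    · exact (d_d_mk (j + 1) (n + 3) (by omega) (by omega) M).symm.trans
        ((congrArg _ hl).trans (hy.mk (j + 1) (n + 3) (by omega) (by omega)))
  have h1 : S.d 1 M = y 1 := by
    refine hE n _ _ ?_ ?_ ?_
    · exact (d_d_mk 0 0 (by omega) (by omega) M).trans
        ((congrArg _ h0).trans (hy.mk 0 0 (by omega) (by omega)).symm)
    · exact (d_d_mk 1 2 (by omega) (by omega) M).symm.trans
        ((congrArg _ (key 3 (by omega) le_rfl)).trans (hy.mk 1 2 (by omega) (by omega)))
    · exact (d_d_mk 1 (n + 3) (by omega) (by omega) M).symm.trans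
        ((congrArg _ hl).trans (hy.mk 1 (n + 3) (by omega) (by omega)))
  refine ⟨M, Subtype.ext (funext ?_)⟩
  rintro ⟨j, hj⟩
  rcases (by omega : j = 0 ∨ j = 1 ∨ j = 2 ∨ (3 ≤ j ∧ j < n + 4) ∨ j = n + 4) with
    rfl | rfl | rfl | ⟨h3, h4⟩ | rfl
  exacts [h0, h1, h2, key j h4 h3, hl]

/-- Horns can be given by families of simplices indexed by all faces. -/
theorem hornMap_surjective {n : ℕ} {l : Fin (n + 3)}
    (H : ∀ y : Fin (n + 3) → S.X (n + 1),
      (∀ (j k : ℕ) (hk : k < n + 2) (h : j ≤ k), j ≠ l.1 → k + 1 ≠ l.1 →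
        S.d ⟨j, h.trans_lt hk⟩ (y ⟨k + 1, by omega⟩) = S.d ⟨k, hk⟩ (y ⟨j, by omega⟩)) →
      ∃ M, ∀ i, i ≠ l → S.d i M = y i) :
    Function.Surjective (S.hornMap (n + 1) l) := by
  rintro ⟨x, hx⟩
  obtain ⟨i₀, hi₀⟩ := exists_ne l
  -- The value at `l` is arbitrary: neither the compatibility conditions nor the conclusion of `H`
  -- involve it.
  obtain ⟨M, hM⟩ := H (fun i => if h : i ≠ l then x ⟨i, h⟩ else x ⟨i₀, hi₀⟩) (by
    intro j k hk h hj hk'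
    have hj' : (⟨j, by omega⟩ : Fin (n + 3)) ≠ l := fun e => hj (congrArg Fin.val e)
    have hk'' : (⟨k + 1, by omega⟩ : Fin (n + 3)) ≠ l := fun e => hk' (congrArg Fin.val e)
    rw [dif_pos hj', dif_pos hk'']
    exact hx ⟨j, h.trans_lt hk⟩ ⟨k, hk⟩ hj' hk'' h)
  refine ⟨M, Subtype.ext (funext ?_)⟩
  rintro ⟨i, hi⟩
  exact (hM i hi).trans (dif_pos hi)

/-- The faces of the simplices of a horn that have to be the faces of the missing simplex. -/
theorem exists_isBoundary_missing {n l : ℕ} (hl : l < n + 4) (y : Fin (n + 4) → S.X (n + 2))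
    (hy : ∀ (j k : ℕ) (hk : k < n + 3) (h : j ≤ k), j ≠ l → k + 1 ≠ l →
      S.d ⟨j, h.trans_lt hk⟩ (y ⟨k + 1, by omega⟩) = S.d ⟨k, hk⟩ (y ⟨j, by omega⟩)) :
    ∃ z : Fin (n + 3) → S.X (n + 1), S.IsBoundary z ∧
      (∀ i (hi : i < l), z ⟨i, by omega⟩ = S.d ⟨l - 1, by omega⟩ (y ⟨i, by omega⟩)) ∧
      (∀ i (hi : i < n + 3) (h : l ≤ i),
        z ⟨i, hi⟩ = S.d ⟨l, by omega⟩ (y ⟨i + 1, by omega⟩)) := by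
  let z : Fin (n + 3) → S.X (n + 1) := fun i =>
    if h : i.1 < l then S.d ⟨l - 1, by omega⟩ (y i.castSucc) else S.d ⟨l, by omega⟩ (y i.succ)
  have z_lt : ∀ i (hi : i < l), z ⟨i, by omega⟩ = S.d ⟨l - 1, by omega⟩ (y ⟨i, by omega⟩) :=
    fun i hi => dif_pos hi
  have z_ge : ∀ i (hi : i < n + 3) (h : l ≤ i),
      z ⟨i, hi⟩ = S.d ⟨l, by omega⟩ (y ⟨i + 1, by omega⟩) := fun i hi h => dif_neg (by simpa using h)
  refine ⟨z, ?_, z_lt, z_ge⟩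
  rintro ⟨j, hj⟩ ⟨k, hk⟩ h
  replace h : j ≤ k := h
  change S.d ⟨j, hj⟩ (z ⟨k + 1, by omega⟩) = S.d ⟨k, hk⟩ (z ⟨j, by omega⟩)
  by_cases h1 : k + 1 < l
  · obtain ⟨l, rfl⟩ : ∃ m, l = m + 2 := ⟨l - 2, by omega⟩
    rw [z_lt _ h1, z_lt j (by omega)]
    exact (d_d_mk j l (by omega) (by omega) _).trans
      ((congrArg _ (hy j k (by omega) h (by omega) (by omega))).trans
        (d_d_mk k l (by omega) (by omega) _).symm)
  · by_cases h2 : j < l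
    · obtain ⟨l, rfl⟩ : ∃ m, l = m + 1 := ⟨l - 1, by omega⟩
      rw [z_ge (k + 1) (by omega) (by omega), z_lt j h2]
      exact (d_d_mk j l (by omega) (by omega) _).trans
        ((congrArg _ (hy j (k + 1) (by omega) (by omega) (by omega) (by omega))).trans
          (d_d_mk l k (by omega) (by omega) _))
    · rw [z_ge (k + 1) (by omega) (by omega), z_ge j (by omega) (by omega)]
      exact (d_d_mk l j (by omega) (by omega) _).symm.trans
        ((congrArg _ (hy (j + 1) (k + 1) (by omega) (by omega) (by omega) (by omega))).trans
          (d_d_mk l k (by omega) (by omega) _))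

/-- A horn can be filled if the boundaries of its missing face and of the simplex can be filled. -/
theorem hornMap_surjective_of_boundaryMap {n : ℕ} (h₁ : Function.Surjective (S.boundaryMap (n + 1)))
    (h₂ : Function.Surjective (S.boundaryMap (n + 2))) (l : Fin (n + 4)) :
    Function.Surjective (S.hornMap (n + 2) l) := by
  apply hornMap_surjective
  intro y hy
  obtain ⟨l, hl⟩ := l
  simp only at hy
  obtain ⟨z, hz, z_lt, z_ge⟩ := exists_isBoundary_missing hl y hy
  obtain ⟨w, hw⟩ := h₁ ⟨z, hz⟩
  have hw' : ∀ i, S.d i w = z i := fun i => congrFun (congrArg Subtype.val hw) i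
  let y' : Fin (n + 4) → S.X (n + 2) := Function.update y ⟨l, hl⟩ w
  have y'_ne : ∀ i (hi : i < n + 4), i ≠ l → y' ⟨i, hi⟩ = y ⟨i, hi⟩ := fun i hi h =>
    Function.update_of_ne (fun e => h (congrArg Fin.val e)) _ _
  have y'_self : y' ⟨l, hl⟩ = w := Function.update_self _ _ _
  have hy' : S.IsBoundary y' := by
    rintro ⟨j, hj⟩ ⟨k, hk⟩ h
    replace h : j ≤ k := h
    change S.d ⟨j, hj⟩ (y' ⟨k + 1, by omega⟩) = S.d ⟨k, hk⟩ (y' ⟨j, by omega⟩)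
    by_cases h1 : j = l
    · subst h1
      rw [y'_self, hw', y'_ne _ _ (by omega), z_ge k hk h]
    · by_cases h2 : k + 1 = l
      · subst h2
        rw [y'_self, hw', y'_ne _ _ (by omega), z_lt j (by omega)]
        rfl
      · rw [y'_ne _ _ h1, y'_ne _ _ h2]
        exact hy j k hk h h1 h2
  obtain ⟨M, hM⟩ := h₂ ⟨y', hy'⟩
  refine ⟨M, fun i hi => (congrFun (congrArg Subtype.val hM) i).trans ?_⟩
  exact y'_ne i.1 i.2 (fun e => hi (Fin.ext e))

theorem eq_of_hornMap_injective {n : ℕ} {l : Fin (n + 2)} (h : Function.Injective (S.hornMap n l))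
    {M M' : S.X (n + 1)} (hM : ∀ i, i ≠ l → S.d i M = S.d i M') : M = M' :=
  h (Subtype.ext (funext fun i => hM i.1 i.2))

theorem exists_of_hornMap_surjective {n : ℕ} {p : Fin (n + 3)}
    (h : Function.Surjective (S.hornMap (n + 1) p)) {z : Fin (n + 3) → S.X (n + 1)}
    (hz : S.IsBoundary z) : ∃ w, ∀ i, i ≠ p → S.d i w = z i := by
  obtain ⟨w, hw⟩ := h ⟨fun i => z i.1, fun j k _ _ hjk => hz j k hjk⟩
  exact ⟨w, fun i hi => congrFun (congrArg Subtype.val hw) ⟨i, hi⟩⟩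

/-- This and `d_d_eq_of_gt` compare a still unknown face of `M` with the prescribed simplex on their
common face with a known one; the known face has the smaller index here and the larger one there. -/
theorem d_d_eq_of_lt {n i j : ℕ} (hj : j < n + 2) (h : i ≤ j) {M : S.X (n + 2)}
    {yi yj : S.X (n + 1)} (hM : S.d ⟨i, by omega⟩ M = yi)
    (hy : S.d ⟨i, by omega⟩ yj = S.d ⟨j, hj⟩ yi) :
    S.d ⟨i, by omega⟩ (S.d ⟨j + 1, by omega⟩ M) = S.d ⟨i, by omega⟩ yj :=
  (d_d_mk i j hj h M).trans ((congrArg _ hM).trans hy.symm)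

theorem d_d_eq_of_gt {n i j : ℕ} (hj : j < n + 2) (h : i ≤ j) {M : S.X (n + 2)}
    {yi yj : S.X (n + 1)} (hM : S.d ⟨j + 1, by omega⟩ M = yj)
    (hy : S.d ⟨i, by omega⟩ yj = S.d ⟨j, hj⟩ yi) :
    S.d ⟨j, hj⟩ (S.d ⟨i, by omega⟩ M) = S.d ⟨j, hj⟩ yi :=
  (d_d_mk i j hj h M).symm.trans ((congrArg _ hM).trans hy)

/-- `FacesFill` builds `M` from the faces 0, 2 and 4. Any further face is correct once it agrees
with the prescribed one on three of its four faces, by uniqueness of fillers in dimension 3. If the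
missing face is 0, 2 or 4, a candidate `w` for it is needed first; it is obtained by matching only
three faces of the boundary `z`, since `z` is not yet known to have a filler. -/
theorem hornMap_three_surjective (hF : S.FacesFill)
    (hi : ∀ l, Function.Injective (S.hornMap 2 l)) (hs : ∀ l, Function.Surjective (S.hornMap 2 l))
    (l : Fin 5) : Function.Surjective (S.hornMap 3 l) := by
  apply hornMap_surjective
  intro y hy
  obtain ⟨z, hz, z_lt, z_ge⟩ := exists_isBoundary_missing l.2 y hy
  have fin4 : ∀ {q : Fin 4 → Prop}, q 0 → q 1 → q 2 → q 3 → ∀ i, q i := fun h0 h1 h2 h3 i => by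
    fin_cases i <;> assumption
  have fin5 : ∀ {q : Fin 5 → Prop}, q 0 → q 1 → q 2 → q 3 → q 4 → ∀ i, q i :=
    fun h0 h1 h2 h3 h4 i => by fin_cases i <;> assumption
  have c : ∀ (j k : ℕ) (hk : k < 4) (h : j ≤ k), j ≠ l.1 → k + 1 ≠ l.1 →
    S.d ⟨j, h.trans_lt hk⟩ (y ⟨k + 1, by omega⟩) = S.d ⟨k, hk⟩ (y ⟨j, by omega⟩) := hy
  have no : ∀ {m : ℕ} {i : Fin m} {q : Prop}, i ≠ i → q := fun h => absurd rfl h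
  fin_cases l
  -- The faces 1 and 3 of `w` are what `FacesFill` needs, and the face 0 serves to identify `d₁ M`;
  -- so the face 2 can be left out.
  · obtain ⟨w, hw⟩ := exists_of_hornMap_surjective (hs 2) hz
    have w0 := (hw 0 (by decide)).trans (z_ge 0 (by omega) (by simp))
    have w1 := (hw 1 (by decide)).trans (z_ge 1 (by omega) (by simp))
    have w3 := (hw 3 (by decide)).trans (z_ge 3 (by omega) (by simp))
    obtain ⟨M, h0, h2, h4⟩ := hF 1 w (y 2) (y 4) w1.symm w3.symm
      (c 2 3 (by omega) (by omega) (by simp) (by simp))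
    have h1 : S.d 1 M = y 1 := eq_of_hornMap_injective (hi 2) (fin4
      (fun _ => d_d_eq_of_lt (j := 0) (by omega) le_rfl h0 w0.symm)
      (fun _ => d_d_eq_of_gt (i := 1) (j := 1) (by omega) (by omega) h2
        (c 1 1 (by omega) (by omega) (by simp) (by simp)))
      no
      (fun _ => d_d_eq_of_gt (i := 1) (j := 3) (by omega) (by omega) h4
        (c 1 3 (by omega) (by omega) (by simp) (by simp))))
    have h3 : S.d 3 M = y 3 := eq_of_hornMap_injective (hi 0) (fin4
      no
      (fun _ => d_d_eq_of_lt (i := 1) (j := 2) (by omega) (by omega) h1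
        (c 1 2 (by omega) (by omega) (by simp) (by simp)))
      (fun _ => d_d_eq_of_lt (i := 2) (j := 2) (by omega) (by omega) h2
        (c 2 2 (by omega) (by omega) (by simp) (by simp)))
      (fun _ => d_d_eq_of_gt (i := 3) (j := 3) (by omega) (by omega) h4
        (c 3 3 (by omega) (by omega) (by simp) (by simp))))
    exact ⟨M, fin5 no (fun _ => h1) (fun _ => h2) (fun _ => h3) (fun _ => h4)⟩
  · obtain ⟨M, h0, h2, h4⟩ := hF 1 (y 0) (y 2) (y 4)
      (c 0 1 (by omega) (by omega) (by simp) (by simp))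
      (c 0 3 (by omega) (by omega) (by simp) (by simp))
      (c 2 3 (by omega) (by omega) (by simp) (by simp))
    have h3 : S.d 3 M = y 3 := eq_of_hornMap_injective (hi 1) (fin4
      (fun _ => d_d_eq_of_lt (i := 0) (j := 2) (by omega) (by omega) h0
        (c 0 2 (by omega) (by omega) (by simp) (by simp)))
      no
      (fun _ => d_d_eq_of_lt (i := 2) (j := 2) (by omega) (by omega) h2
        (c 2 2 (by omega) (by omega) (by simp) (by simp)))
      (fun _ => d_d_eq_of_gt (i := 3) (j := 3) (by omega) (by omega) h4
        (c 3 3 (by omega) (by omega) (by simp) (by simp))))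
    exact ⟨M, fin5 (fun _ => h0) no (fun _ => h2) (fun _ => h3) (fun _ => h4)⟩
  -- Here `FacesFill` needs the faces 0 and 3 of `w`, and `d₃ M` needs the face 2.
  · obtain ⟨w, hw⟩ := exists_of_hornMap_surjective (hs 1) hz
    have w0 := (hw 0 (by decide)).trans (z_lt 0 (by simp))
    have w2 := (hw 2 (by decide)).trans (z_ge 2 (by omega) (by simp))
    have w3 := (hw 3 (by decide)).trans (z_ge 3 (by omega) (by simp))
    obtain ⟨M, h0, h2, h4⟩ := hF 1 (y 0) w (y 4) w0
      (c 0 3 (by omega) (by omega) (by simp) (by simp)) w3.symm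
    have h3 : S.d 3 M = y 3 := eq_of_hornMap_injective (hi 1) (fin4
      (fun _ => d_d_eq_of_lt (i := 0) (j := 2) (by omega) (by omega) h0
        (c 0 2 (by omega) (by omega) (by simp) (by simp)))
      no
      (fun _ => d_d_eq_of_lt (i := 2) (j := 2) (by omega) (by omega) h2 w2.symm)
      (fun _ => d_d_eq_of_gt (i := 3) (j := 3) (by omega) (by omega) h4
        (c 3 3 (by omega) (by omega) (by simp) (by simp))))
    have h1 : S.d 1 M = y 1 := eq_of_hornMap_injective (hi 1) (fin4
      (fun _ => d_d_eq_of_lt (i := 0) (j := 0) (by omega) (by omega) h0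
        (c 0 0 (by omega) (by omega) (by simp) (by simp)))
      no
      (fun _ => d_d_eq_of_gt (i := 1) (j := 2) (by omega) (by omega) h3
        (c 1 2 (by omega) (by omega) (by simp) (by simp)))
      (fun _ => d_d_eq_of_gt (i := 1) (j := 3) (by omega) (by omega) h4
        (c 1 3 (by omega) (by omega) (by simp) (by simp))))
    exact ⟨M, fin5 (fun _ => h0) (fun _ => h1) no (fun _ => h3) (fun _ => h4)⟩
  · obtain ⟨M, h0, h2, h4⟩ := hF 1 (y 0) (y 2) (y 4)
      (c 0 1 (by omega) (by omega) (by simp) (by simp))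
      (c 0 3 (by omega) (by omega) (by simp) (by simp))
      (c 2 3 (by omega) (by omega) (by simp) (by simp))
    have h1 : S.d 1 M = y 1 := eq_of_hornMap_injective (hi 2) (fin4
      (fun _ => d_d_eq_of_lt (i := 0) (j := 0) (by omega) (by omega) h0
        (c 0 0 (by omega) (by omega) (by simp) (by simp)))
      (fun _ => d_d_eq_of_gt (i := 1) (j := 1) (by omega) (by omega) h2
        (c 1 1 (by omega) (by omega) (by simp) (by simp)))
      no
      (fun _ => d_d_eq_of_gt (i := 1) (j := 3) (by omega) (by omega) h4
        (c 1 3 (by omega) (by omega) (by simp) (by simp))))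
    exact ⟨M, fin5 (fun _ => h0) (fun _ => h1) (fun _ => h2) no (fun _ => h4)⟩
  -- Here `FacesFill` needs the faces 0 and 2 of `w`, and `d₁ M` needs the face 1.
  · obtain ⟨w, hw⟩ := exists_of_hornMap_surjective (hs 3) hz
    have w0 := (hw 0 (by decide)).trans (z_lt 0 (by simp))
    have w1 := (hw 1 (by decide)).trans (z_lt 1 (by simp))
    have w2 := (hw 2 (by decide)).trans (z_lt 2 (by simp))
    obtain ⟨M, h0, h2, h4⟩ := hF 1 (y 0) (y 2) w
      (c 0 1 (by omega) (by omega) (by simp) (by simp)) w0 w2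
    have h1 : S.d 1 M = y 1 := eq_of_hornMap_injective (hi 2) (fin4
      (fun _ => d_d_eq_of_lt (i := 0) (j := 0) (by omega) (by omega) h0
        (c 0 0 (by omega) (by omega) (by simp) (by simp)))
      (fun _ => d_d_eq_of_gt (i := 1) (j := 1) (by omega) (by omega) h2
        (c 1 1 (by omega) (by omega) (by simp) (by simp)))
      no
      (fun _ => d_d_eq_of_gt (i := 1) (j := 3) (by omega) (by omega) h4 w1))
    have h3 : S.d 3 M = y 3 := eq_of_hornMap_injective (hi 3) (fin4
      (fun _ => d_d_eq_of_lt (i := 0) (j := 2) (by omega) (by omega) h0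
        (c 0 2 (by omega) (by omega) (by simp) (by simp)))
      (fun _ => d_d_eq_of_lt (i := 1) (j := 2) (by omega) (by omega) h1
        (c 1 2 (by omega) (by omega) (by simp) (by simp)))
      (fun _ => d_d_eq_of_lt (i := 2) (j := 2) (by omega) (by omega) h2
        (c 2 2 (by omega) (by omega) (by simp) (by simp)))
      no)
    exact ⟨M, fin5 (fun _ => h0) (fun _ => h1) (fun _ => h2) (fun _ => h3) no⟩

end SimplicialSet

/-! ### The faces 0, 2 and last of a matrix. -/

namespace CrossedMonoid

section Rows

variable {α : Type w} [Monoid α]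

theorem contractNth_zero_succ {k : ℕ} (a : Fin (k + 2) → α) (i : Fin k) :
    Fin.contractNth 0 (· * ·) a i.succ = a i.succ.succ :=
  Fin.contractNth_apply_of_gt _ _ _ _ (by simp)

theorem contractNth_zero_zero {k : ℕ} (a : Fin (k + 2) → α) :
    Fin.contractNth 0 (· * ·) a 0 = a 0 * a 1 :=
  Fin.contractNth_apply_of_eq _ _ _ _ rfl

theorem contractNth_last {k : ℕ} (a : Fin (k + 1) → α) :
    Fin.contractNth (Fin.last k) (· * ·) a = fun i => a i.castSucc :=
  funext fun i => Fin.contractNth_apply_of_lt _ _ _ _ (by simp)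

theorem eq_of_contractNth_zero_last (hα : ∀ a : α, IsUnit a) {k : ℕ} {a b : Fin (k + 2) → α}
    (h0 : Fin.contractNth 0 (· * ·) a = Fin.contractNth 0 (· * ·) b)
    (hl : Fin.contractNth (Fin.last _) (· * ·) a = Fin.contractNth (Fin.last _) (· * ·) b) :
    a = b := by
  rw [contractNth_last, contractNth_last] at hl
  have h : a 0 = b 0 := congrFun hl 0
  have h1 := congrFun h0 0
  rw [contractNth_zero_zero, contractNth_zero_zero, h] at h1
  funext i
  induction i using Fin.cases with
  | zero => exact h
  | succ i =>
    induction i using Fin.cases with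
    | zero => exact (hα _).mul_left_cancel h1
    | succ i =>
      have := congrFun h0 i.succ
      rwa [contractNth_zero_succ, contractNth_zero_succ] at this

theorem exists_contractNth_zero_last (hα : ∀ a : α, IsUnit a) {k : ℕ} (a' a'' : Fin (k + 1) → α)
    (h : Fin.contractNth 0 (· * ·) a' = Fin.contractNth (Fin.last _) (· * ·) a'') :
    ∃ a : Fin (k + 2) → α, Fin.contractNth 0 (· * ·) a = a'' ∧
      Fin.contractNth (Fin.last _) (· * ·) a = a' := by
  obtain ⟨c, hc⟩ : ∃ c, a' 0 * c = a'' 0 := by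
    obtain ⟨v, hv⟩ := hα (a' 0)
    exact ⟨↑v⁻¹ * a'' 0, by rw [← hv, ← mul_assoc, v.mul_inv, one_mul]⟩
  -- The first entry is read off from `a'`, the second is the quotient `a'₀⁻¹ a''₀`, and the others
  -- are those of `a''`; `h` ensures that `a'` is recovered beyond its first entry.
  refine ⟨Fin.cons (a' 0) (Fin.cons c (fun i : Fin k => a'' i.succ)), ?_, ?_⟩
  · funext i
    induction i using Fin.cases with
    | zero => rw [contractNth_zero_zero]; exact hc
    | succ i => rw [contractNth_zero_succ]; rfl
  · rw [contractNth_last] at h ⊢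
    funext i
    induction i using Fin.cases with
    | zero => rfl
    | succ i =>
      cases k with
      | zero => exact i.elim0
      | succ k =>
        have h' := congrFun h i
        induction i using Fin.cases with
        | zero =>
          rw [contractNth_zero_zero] at h'
          exact (hα _).mul_left_cancel (hc.trans h'.symm)
        | succ i =>
          rw [contractNth_zero_succ] at h'
          exact h'.symm

end Rows

variable {C : Type u} [Category.{v} C] {P : CrossedMonoid.{v, u, w} C}

/-- Since the objects are part of the data, entries can only be compared heterogeneously until the
objects have been identified. -/
theorem NerveObj.mk_cons_inj {n : ℕ} {x y x' y' : C} {m : y ⟶ x} {a : Fin n → P.M y} {T : Tri P n y}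
    {m' : y' ⟶ x'} {a' : Fin n → P.M y'} {T' : Tri P n y'}
    (h : (⟨x, .cons m a T⟩ : NerveObj P (n + 1)) = ⟨x', .cons m' a' T'⟩) :
    x = x' ∧ y = y' ∧ m ≍ m' ∧ a ≍ a' ∧ T ≍ T' := by
  cases h
  exact ⟨rfl, rfl, HEq.rfl, HEq.rfl, HEq.rfl⟩

theorem facesDetermine_nerve (hP : P.IsCrossedModule) : P.nerve.FacesDetermine := by
  rintro k ⟨x, M⟩ ⟨x', M'⟩ h0 h2 hl
  cases M with
  | cons m a T =>
  cases M' with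
  | cons m' a' T' =>
  obtain ⟨rfl, h0⟩ := Sigma.mk.inj h0
  obtain rfl := eq_of_heq h0
  obtain ⟨rfl, -, hm, ha, -⟩ := NerveObj.mk_cons_inj h2
  obtain ⟨-, -, -, ha', -⟩ := NerveObj.mk_cons_inj hl
  obtain rfl := eq_of_heq hm
  obtain rfl := eq_of_contractNth_zero_last hP.isUnit (eq_of_heq ha) (eq_of_heq ha')
  rfl

/-- The first two compatibilities say that the lower rows of the faces 2 and last are the faces 1
and last of `T`, so `T` can serve as the lower rows of the filler. The third one concerns the first
rows and is the hypothesis of `exists_contractNth_zero_last`. -/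
theorem facesFill_nerve (hP : P.IsCrossedModule) : P.nerve.FacesFill := by
  rintro k ⟨y, T⟩ ⟨x, M⟩ ⟨x', M'⟩ h0 hl h2
  cases M with
  | cons m a T₁ =>
  cases M' with
  | cons m' a' T₂ =>
  obtain ⟨rfl, h0⟩ := Sigma.mk.inj h0
  obtain rfl := eq_of_heq h0
  obtain ⟨rfl, hl⟩ := Sigma.mk.inj hl
  obtain rfl := eq_of_heq hl
  obtain ⟨rfl, -, hm, ha, -⟩ := NerveObj.mk_cons_inj h2
  obtain rfl := eq_of_heq hm
  obtain ⟨b, rfl, rfl⟩ := exists_contractNth_zero_last hP.isUnit a' a (eq_of_heq ha)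
  exact ⟨⟨_, .cons m' b T⟩, rfl, rfl, rfl⟩

end CrossedMonoid

/-! ### Coordinates for simplices of dimension 1, 2 and 3. -/

namespace CrossedMonoid

variable {C : Type u} [Category.{v} C] {P : CrossedMonoid.{v, u, w} C}

namespace NerveObj

variable {x y z t : C}

/-- The `1 × 1` matrix `(m)`. -/
def edge (P : CrossedMonoid.{v, u, w} C) (m : y ⟶ x) : P.nerve.X 1 :=
  ⟨x, .cons m (fun i => i.elim0) (.nil y)⟩

/-- The `2 × 2` matrix with diagonal entries `m`, `m'` and the entry `a` above the diagonal. -/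
def triangle (m : y ⟶ x) (a : P.M y) (m' : z ⟶ y) : P.nerve.X 2 :=
  ⟨x, .cons m (fun _ => a) (edge P m').2⟩

/-- The `3 × 3` matrix with rows `(m, a, b)`, `(m', c)` and the last diagonal entry `m''` in `C`. -/
def tetrahedron (m : y ⟶ x) (a b : P.M y) (m' : z ⟶ y) (c : P.M z) (m'' : t ⟶ z) : P.nerve.X 3 :=
  ⟨x, .cons m ![a, b] (triangle m' c m'').2⟩

theorem exists_edge (T : P.nerve.X 1) : ∃ (x y : C) (m : y ⟶ x), T = edge P m := by
  obtain ⟨x, _ | ⟨m, a, _ | _⟩⟩ := T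
  refine ⟨_, _, m, congrArg (Sigma.mk x) ?_⟩
  congr 1
  exact funext fun i => i.elim0

theorem exists_triangle (T : P.nerve.X 2) :
    ∃ (x y z : C) (m : y ⟶ x) (a : P.M y) (m' : z ⟶ y), T = triangle m a m' := by
  obtain ⟨x, _ | ⟨m, a, _ | ⟨m', b, _ | _⟩⟩⟩ := T
  refine ⟨_, _, _, m, a 0, m', congrArg (Sigma.mk x) ?_⟩
  change Tri.cons _ _ _ = Tri.cons _ _ (Tri.cons _ _ _)
  congr 1
  · funext i
    rw [Subsingleton.elim (α := Fin 1) i 0]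
  · congr 1
    exact funext fun i => i.elim0

theorem exists_tetrahedron (T : P.nerve.X 3) :
    ∃ (x y z t : C) (m : y ⟶ x) (a b : P.M y) (m' : z ⟶ y) (c : P.M z) (m'' : t ⟶ z),
      T = tetrahedron m a b m' c m'' := by
  obtain ⟨x, _ | ⟨m, a, T⟩⟩ := T
  obtain ⟨y, z, t, m', c, m'', h⟩ := exists_triangle (P := P) ⟨_, T⟩
  obtain ⟨rfl, h⟩ := Sigma.mk.inj h
  obtain rfl := eq_of_heq h
  refine ⟨_, _, _, _, m, a 0, a 1, m', c, m'', congrArg (Sigma.mk x) ?_⟩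
  change Tri.cons _ _ _ = Tri.cons _ _ _
  congr 1
  funext i
  fin_cases i <;> rfl

theorem edge_inj {x' y' : C} {m : y ⟶ x} {m' : y' ⟶ x'} (h : edge P m = edge P m') :
    x = x' ∧ y = y' ∧ m ≍ m' := by
  obtain ⟨h1, h2, h3, -⟩ := mk_cons_inj h
  exact ⟨h1, h2, h3⟩

theorem triangle_inj {x' y' z' : C} {m : y ⟶ x} {a : P.M y} {m' : z ⟶ y} {n : y' ⟶ x'}
    {b : P.M y'} {n' : z' ⟶ y'} (h : triangle m a m' = triangle n b n') :
    x = x' ∧ y = y' ∧ z = z' ∧ m ≍ n ∧ a ≍ b ∧ m' ≍ n' := by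
  obtain ⟨rfl, rfl, hm, ha, h⟩ := mk_cons_inj h
  obtain ⟨-, rfl, hm'⟩ := edge_inj (P := P) (congrArg (Sigma.mk _) (eq_of_heq h))
  exact ⟨rfl, rfl, rfl, hm, heq_of_eq (congrFun (eq_of_heq ha) 0), hm'⟩

variable (m : y ⟶ x) (a b : P.M y) (m' : z ⟶ y) (c : P.M z) (m'' : t ⟶ z)

theorem d_zero_edge : P.nerve.d 0 (edge P m) = ⟨y, .nil y⟩ := rfl

theorem d_one_edge : P.nerve.d 1 (edge P m) = ⟨x, .nil x⟩ := rfl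

theorem d_zero_triangle : P.nerve.d 0 (triangle m a m') = edge P m' := rfl

theorem d_one_triangle : P.nerve.d 1 (triangle m a m') = edge P (m' ≫ P.del a ≫ m) := by
  refine congrArg (Sigma.mk x) ?_
  change Tri.cons _ _ _ = Tri.cons _ _ _
  congr 1
  exact funext fun i => i.elim0

theorem d_two_triangle : P.nerve.d 2 (triangle m a m') = edge P m := by
  refine congrArg (Sigma.mk x) ?_
  change Tri.cons _ _ _ = Tri.cons _ _ _
  congr 1
  exact funext fun i => i.elim0

theorem d_zero_tetrahedron :
    P.nerve.d 0 (tetrahedron m a b m' c m'') = triangle m' c m'' := rfl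

theorem d_one_tetrahedron : P.nerve.d 1 (tetrahedron m a b m' c m'') =
    triangle (m' ≫ P.del a ≫ m) (P.act m' b * c) m'' := by
  refine congrArg (Sigma.mk x) ?_
  change Tri.cons _ _ _ = Tri.cons _ _ _
  congr 1
  funext i
  obtain rfl := Subsingleton.elim (α := Fin 1) i 0
  -- For the first entry the product inside `η` is empty, so `η` is just `m'`.
  change P.act (P.del (Fin.partialProd _ 0) ≫ m') b * c = _
  rw [Fin.partialProd_zero, del_one, Category.id_comp]

theorem d_two_tetrahedron : P.nerve.d 2 (tetrahedron m a b m' c m'') =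
    triangle m (a * b) (m'' ≫ P.del c ≫ m') := by
  refine congrArg (Sigma.mk x) ?_
  change Tri.cons _ _ _ = Tri.cons _ _ (Tri.cons _ _ _)
  congr 1
  · funext i
    obtain rfl := Subsingleton.elim (α := Fin 1) i 0
    rfl
  · change Tri.cons _ _ _ = Tri.cons _ _ _
    congr 1
    exact funext fun i => i.elim0

theorem d_three_tetrahedron :
    P.nerve.d 3 (tetrahedron m a b m' c m'') = triangle m a m' := by
  refine congrArg (Sigma.mk x) ?_
  change Tri.cons _ _ _ = Tri.cons _ _ (Tri.cons _ _ _)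
  congr 1
  · funext i
    obtain rfl := Subsingleton.elim (α := Fin 1) i 0
    rfl
  · change Tri.cons _ _ _ = Tri.cons _ _ _
    congr 1
    exact funext fun i => i.elim0

end NerveObj

end CrossedMonoid

/-! ### Boundaries in dimension 3, and horns in dimensions 2 and 3. -/

namespace CrossedMonoid

variable {C : Type u} [Category.{v} C] {P : CrossedMonoid.{v, u, w} C}

namespace IsCrossedModule

theorem exists_mul_eq (hP : P.IsCrossedModule) {t : C} (a b : P.M t) : ∃ c, a * c = b := by
  obtain ⟨v, rfl⟩ := hP.isUnit a
  exact ⟨↑v⁻¹ * b, by rw [← mul_assoc, v.mul_inv, one_mul]⟩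

theorem exists_mul_eq' (hP : P.IsCrossedModule) {t : C} (a b : P.M t) : ∃ c, c * a = b := by
  obtain ⟨v, rfl⟩ := hP.isUnit a
  exact ⟨b * ↑v⁻¹, by rw [mul_assoc, v.inv_mul, mul_one]⟩

theorem exists_act_eq (hP : P.IsCrossedModule) {s t : C} (α : s ⟶ t) (b : P.M s) : ∃ c, P.act α c = b := by
  have := hP.isIso α
  exact ⟨P.act (inv α) b, by rw [act_act, IsIso.hom_inv_id, act_id]⟩

theorem act_injective (hP : P.IsCrossedModule) {s t : C} (α : s ⟶ t) : Function.Injective (P.act α) := by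
  have := hP.isIso α
  intro a b h
  have := congrArg (P.act (inv α)) h
  rwa [act_act, act_act, IsIso.inv_hom_id, act_id, act_id] at this

end IsCrossedModule

open NerveObj

/-- Five of the six compatibilities identify diagonal entries and yield this normal form. The sixth,
`d₁ M² = d₁ M¹`, would say that the equation of the theorem holds after applying `∂`, up to
cancelling in the groupoid. -/
theorem Boundary.exists_eq (M : P.nerve.Boundary 2) :
    ∃ (x y z t : C) (m : y ⟶ x) (m' : z ⟶ y) (m'' : t ⟶ z) (a₀ a₁ : P.M z) (a₂ a₃ : P.M y),
      M.1 = ![triangle m' a₀ m'', triangle (m' ≫ P.del a₃ ≫ m) a₁ m'',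
        triangle m a₂ (m'' ≫ P.del a₀ ≫ m'), triangle m a₃ m'] := by
  obtain ⟨f, hf⟩ := M
  have h00 := hf 0 0 (by decide)
  have h01 := hf 0 1 (by decide)
  have h02 := hf 0 2 (by decide)
  have h12 := hf 1 2 (by decide)
  have h22 := hf 2 2 (by decide)
  change P.nerve.d 0 (f 1) = P.nerve.d 0 (f 0) at h00
  change P.nerve.d 0 (f 2) = P.nerve.d 1 (f 0) at h01
  change P.nerve.d 0 (f 3) = P.nerve.d 2 (f 0) at h02
  change P.nerve.d 1 (f 3) = P.nerve.d 2 (f 1) at h12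
  change P.nerve.d 2 (f 3) = P.nerve.d 2 (f 2) at h22
  obtain ⟨_, _, _, _, _, _, e0⟩ := exists_triangle (f 0)
  obtain ⟨_, _, _, _, _, _, e1⟩ := exists_triangle (f 1)
  obtain ⟨_, _, _, _, _, _, e2⟩ := exists_triangle (f 2)
  obtain ⟨_, _, _, _, _, _, e3⟩ := exists_triangle (f 3)
  simp only [e0, e1, e2, e3, d_zero_triangle, d_one_triangle, d_two_triangle] at h00 h01 h02 h12 h22
  obtain ⟨rfl, rfl, h⟩ := edge_inj h00
  obtain rfl := eq_of_heq h
  obtain ⟨rfl, rfl, h⟩ := edge_inj h02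
  obtain rfl := eq_of_heq h
  obtain ⟨rfl, -, h⟩ := edge_inj h12
  obtain rfl := eq_of_heq h
  obtain ⟨rfl, rfl, h⟩ := edge_inj h22
  obtain rfl := eq_of_heq h
  obtain ⟨-, rfl, h⟩ := edge_inj h01
  obtain rfl := eq_of_heq h
  rename_i t x y z m a₃ m' a₁ a₀ _ _ a₂ _ m'' _
  refine ⟨x, y, z, t, m, m', m'', a₀, a₁, a₂, a₃, ?_⟩
  funext i
  fin_cases i
  exacts [e0, e1, e2, e3]

theorem mem_range_boundaryMap_iff (hP : P.IsCrossedModule) (M : P.nerve.Boundary 2) :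
    M ∈ Set.range (P.nerve.boundaryMap 2) ↔ ImageEquation M := by
  obtain ⟨x, y, z, t, m, m', m'', a₀, a₁, a₂, a₃, e⟩ := Boundary.exists_eq M
  obtain ⟨f, hf⟩ := M
  obtain rfl : f = _ := e
  -- In normal form the objects agree definitionally, so the transports disappear.
  change _ ↔ P.act m' a₃ * a₁ = P.act m' a₂ * a₀
  -- The face 2 forces this `b` as the entry `m₁₃` of any filler.
  obtain ⟨b, rfl⟩ := hP.exists_mul_eq a₃ a₂
  constructor
  · rintro ⟨T, hT⟩
    have hT' : (fun i => P.nerve.d i T) = _ := congrArg Subtype.val hT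
    obtain ⟨_, _, _, _, n, c, b', n', c', n'', rfl⟩ := exists_tetrahedron T
    obtain ⟨rfl, rfl, rfl, h1, h2, h3⟩ :=
      triangle_inj ((d_zero_tetrahedron n c b' n' c' n'').symm.trans (congrFun hT' 0))
    obtain ⟨rfl, -, -, h4, h5, -⟩ :=
      triangle_inj ((d_three_tetrahedron n c b' n' c' n'').symm.trans (congrFun hT' 3))
    obtain ⟨-, -, -, -, h6, -⟩ :=
      triangle_inj ((d_two_tetrahedron n c b' n' c' n'').symm.trans (congrFun hT' 2))
    obtain ⟨-, -, -, -, h7, -⟩ :=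
      triangle_inj ((d_one_tetrahedron n c b' n' c' n'').symm.trans (congrFun hT' 1))
    obtain rfl := eq_of_heq h1
    obtain rfl := eq_of_heq h2
    obtain rfl := eq_of_heq h5
    obtain rfl := (hP.isUnit c).mul_left_cancel (eq_of_heq h6)
    rw [← eq_of_heq h7, map_mul, mul_assoc]
  · intro h
    rw [map_mul, mul_assoc] at h
    obtain rfl := (hP.isUnit _).mul_left_cancel h
    refine ⟨tetrahedron m a₃ b m' a₀ m'', Subtype.ext (funext fun i => ?_)⟩
    fin_cases i
    exacts [d_zero_tetrahedron m a₃ b m' a₀ m'', d_one_tetrahedron m a₃ b m' a₀ m'',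
      d_two_tetrahedron m a₃ b m' a₀ m'', d_three_tetrahedron m a₃ b m' a₀ m'']

/-- In every case the faces 0 or 3 give entries directly; the others follow from `a b` in the face 2
and `b ^ m' c` in the face 1 by cancellation and by invertibility of the action. -/
theorem hornMap_two_injective (hP : P.IsCrossedModule) (l : Fin 4) :
    Function.Injective (P.nerve.hornMap 2 l) := by
  intro M M' h
  replace h : ∀ i, i ≠ l → P.nerve.d i M = P.nerve.d i M' :=
    fun i hi => congrFun (congrArg Subtype.val h) ⟨i, hi⟩
  obtain ⟨_, _, _, _, m, a, b, m', c, m'', rfl⟩ := exists_tetrahedron M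
  obtain ⟨_, _, _, _, n, a', b', n', c', n'', rfl⟩ := exists_tetrahedron M'
  fin_cases l
  · have h1 := h 1 (by decide)
    have h2 := h 2 (by decide)
    have h3 := h 3 (by decide)
    rw [d_one_tetrahedron, d_one_tetrahedron] at h1
    rw [d_two_tetrahedron, d_two_tetrahedron] at h2
    rw [d_three_tetrahedron, d_three_tetrahedron] at h3
    obtain ⟨rfl, rfl, rfl, h4, h5, h6⟩ := triangle_inj h3
    obtain rfl := eq_of_heq h4
    obtain rfl := eq_of_heq h5
    obtain rfl := eq_of_heq h6
    obtain ⟨-, -, rfl, -, h8, -⟩ := triangle_inj h2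
    obtain rfl := (hP.isUnit _).mul_left_cancel (eq_of_heq h8)
    obtain ⟨-, -, -, -, h9, h10⟩ := triangle_inj h1
    obtain rfl := (hP.isUnit _).mul_left_cancel (eq_of_heq h9)
    obtain rfl := eq_of_heq h10
    rfl
  · exact facesDetermine_nerve hP 0 _ _ (h 0 (by decide)) (h 2 (by decide)) (h 3 (by decide))
  · have h1 := h 1 (by decide)
    have h0 := h 0 (by decide)
    have h3 := h 3 (by decide)
    rw [d_one_tetrahedron, d_one_tetrahedron] at h1
    rw [d_zero_tetrahedron, d_zero_tetrahedron] at h0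
    rw [d_three_tetrahedron, d_three_tetrahedron] at h3
    obtain ⟨rfl, rfl, rfl, h4, h5, h6⟩ := triangle_inj h3
    obtain rfl := eq_of_heq h4
    obtain rfl := eq_of_heq h5
    obtain rfl := eq_of_heq h6
    obtain ⟨-, -, rfl, -, h8, h9⟩ := triangle_inj h0
    obtain rfl := eq_of_heq h8
    obtain rfl := eq_of_heq h9
    obtain ⟨-, -, -, -, h10, -⟩ := triangle_inj h1
    obtain rfl := hP.act_injective _ ((hP.isUnit _).mul_right_cancel (eq_of_heq h10))
    rfl
  · have h1 := h 1 (by decide)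
    have h0 := h 0 (by decide)
    have h2 := h 2 (by decide)
    rw [d_one_tetrahedron, d_one_tetrahedron] at h1
    rw [d_zero_tetrahedron, d_zero_tetrahedron] at h0
    rw [d_two_tetrahedron, d_two_tetrahedron] at h2
    obtain ⟨rfl, rfl, rfl, h4, h5, h6⟩ := triangle_inj h0
    obtain rfl := eq_of_heq h4
    obtain rfl := eq_of_heq h5
    obtain rfl := eq_of_heq h6
    obtain ⟨rfl, -, -, -, h10, -⟩ := triangle_inj h1
    obtain rfl := hP.act_injective _ ((hP.isUnit _).mul_right_cancel (eq_of_heq h10))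
    obtain ⟨-, -, -, h8, h9, -⟩ := triangle_inj h2
    obtain rfl := eq_of_heq h8
    obtain rfl := (hP.isUnit _).mul_right_cancel (eq_of_heq h9)
    rfl

theorem hornMap_two_surjective (hP : P.IsCrossedModule) (l : Fin 4) :
    Function.Surjective (P.nerve.hornMap 2 l) := by
  apply SimplicialSet.hornMap_surjective
  intro f hf
  have iso : ∀ {s t : C} (α : s ⟶ t), IsIso α := hP.isIso
  have fin4 : ∀ {q : Fin 4 → Prop}, q 0 → q 1 → q 2 → q 3 → ∀ i, q i := fun h0 h1 h2 h3 i => by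
    fin_cases i <;> assumption
  have no : ∀ {m : ℕ} {i : Fin m} {q : Prop}, i ≠ i → q := fun h => absurd rfl h
  obtain ⟨_, _, _, m₀, a₀, n₀, e0⟩ := exists_triangle (f 0)
  obtain ⟨_, _, _, m₁, a₁, n₁, e1⟩ := exists_triangle (f 1)
  obtain ⟨_, _, _, m₂, a₂, n₂, e2⟩ := exists_triangle (f 2)
  obtain ⟨_, _, _, m₃, a₃, n₃, e3⟩ := exists_triangle (f 3)
  fin_cases l
  · have h11 : P.nerve.d 1 (f 2) = P.nerve.d 1 (f 1) :=
      hf 1 1 (by omega) (by omega) (by simp) (by simp)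
    have h12 : P.nerve.d 1 (f 3) = P.nerve.d 2 (f 1) :=
      hf 1 2 (by omega) (by omega) (by simp) (by simp)
    have h22 : P.nerve.d 2 (f 3) = P.nerve.d 2 (f 2) :=
      hf 2 2 (by omega) (by omega) (by simp) (by simp)
    simp only [e1, e2, e3, d_one_triangle, d_two_triangle] at h11 h12 h22
    obtain ⟨rfl, rfl, h⟩ := edge_inj h12
    obtain rfl := eq_of_heq h
    obtain ⟨rfl, rfl, h⟩ := edge_inj h22
    obtain rfl := eq_of_heq h
    obtain ⟨-, rfl, h⟩ := edge_inj h11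
    obtain ⟨b, rfl⟩ := hP.exists_mul_eq a₃ a₂
    obtain ⟨c, rfl⟩ := hP.exists_mul_eq (P.act n₃ b) a₁
    -- All entries of the filler are now chosen; that the face 2 has the right second diagonal entry
    -- follows from `d₁ M² = d₁ M¹` by moving `∂(b ^ n₃)` past `n₃`.
    have h' : n₂ = n₁ ≫ P.del c ≫ n₃ := by
      rw [del_mul, del_mul] at h
      have h2 := eq_of_heq h
      simp only [Category.assoc] at h2
      rw [← cancel_mono (P.del b ≫ P.del a₃ ≫ m₃), h2, ← Category.assoc (P.del (P.act n₃ b)),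
        del_act]
      simp only [Category.assoc]
    subst h'
    refine ⟨tetrahedron m₃ a₃ b n₃ c n₁, fin4 no ?_ ?_ ?_⟩ <;> intro _
    exacts [(d_one_tetrahedron _ _ _ _ _ _).trans e1.symm,
      (d_two_tetrahedron _ _ _ _ _ _).trans e2.symm,
      (d_three_tetrahedron _ _ _ _ _ _).trans e3.symm]
  · obtain ⟨M, h0, h2, h3⟩ := facesFill_nerve hP 0 (f 0) (f 2) (f 3)
      (hf 0 1 (by omega) (by omega) (by simp) (by simp))
      (hf 0 2 (by omega) (by omega) (by simp) (by simp))
      (hf 2 2 (by omega) (by omega) (by simp) (by simp))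
    exact ⟨M, fin4 (fun _ => h0) no (fun _ => h2) (fun _ => h3)⟩
  · have h00 : P.nerve.d 0 (f 1) = P.nerve.d 0 (f 0) :=
      hf 0 0 (by omega) (by omega) (by simp) (by simp)
    have h02 : P.nerve.d 0 (f 3) = P.nerve.d 2 (f 0) :=
      hf 0 2 (by omega) (by omega) (by simp) (by simp)
    have h12 : P.nerve.d 1 (f 3) = P.nerve.d 2 (f 1) :=
      hf 1 2 (by omega) (by omega) (by simp) (by simp)
    simp only [e0, e1, e3, d_zero_triangle, d_one_triangle, d_two_triangle] at h00 h02 h12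
    obtain ⟨rfl, rfl, h⟩ := edge_inj h00
    obtain rfl := eq_of_heq h
    obtain ⟨rfl, rfl, h⟩ := edge_inj h02
    obtain rfl := eq_of_heq h
    obtain ⟨rfl, -, h⟩ := edge_inj h12
    obtain rfl := eq_of_heq h
    obtain ⟨b, rfl⟩ := hP.exists_mul_eq' a₀ a₁
    obtain ⟨b, rfl⟩ := hP.exists_act_eq n₃ b
    refine ⟨tetrahedron m₃ a₃ b n₃ a₀ n₁, fin4 ?_ ?_ no ?_⟩ <;> intro _
    exacts [(d_zero_tetrahedron _ _ _ _ _ _).trans e0.symm,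
      (d_one_tetrahedron _ _ _ _ _ _).trans e1.symm,
      (d_three_tetrahedron _ _ _ _ _ _).trans e3.symm]
  · have h00 : P.nerve.d 0 (f 1) = P.nerve.d 0 (f 0) :=
      hf 0 0 (by omega) (by omega) (by simp) (by simp)
    have h01 : P.nerve.d 0 (f 2) = P.nerve.d 1 (f 0) :=
      hf 0 1 (by omega) (by omega) (by simp) (by simp)
    have h11 : P.nerve.d 1 (f 2) = P.nerve.d 1 (f 1) :=
      hf 1 1 (by omega) (by omega) (by simp) (by simp)
    simp only [e0, e1, e2, d_zero_triangle, d_one_triangle] at h00 h01 h11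
    obtain ⟨rfl, rfl, h⟩ := edge_inj h00
    obtain rfl := eq_of_heq h
    obtain ⟨rfl, rfl, h⟩ := edge_inj h01
    obtain rfl := eq_of_heq h
    obtain ⟨rfl, -, h⟩ := edge_inj h11
    obtain ⟨b, rfl⟩ := hP.exists_mul_eq' a₀ a₁
    obtain ⟨b, rfl⟩ := hP.exists_act_eq m₀ b
    obtain ⟨a, rfl⟩ := hP.exists_mul_eq' b a₂
    -- As in the case `l = 0`, the compatibility `d₁ M² = d₁ M¹` forces the remaining diagonal
    -- entry, here the corner of the face 1.
    have h' : m₁ = m₀ ≫ P.del a ≫ m₂ := by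
      rw [del_mul, del_mul] at h
      have h2 := eq_of_heq h
      simp only [Category.assoc] at h2
      rw [← Category.assoc m₀, ← del_act] at h2
      rw [← cancel_epi (n₁ ≫ P.del a₀ ≫ P.del (P.act m₀ b))]
      simp only [Category.assoc] at h2 ⊢
      exact h2.symm
    subst h'
    refine ⟨tetrahedron m₂ a b m₀ a₀ n₁, fin4 ?_ ?_ ?_ no⟩ <;> intro _
    exacts [(d_zero_tetrahedron _ _ _ _ _ _).trans e0.symm,
      (d_one_tetrahedron _ _ _ _ _ _).trans e1.symm,
      (d_two_tetrahedron _ _ _ _ _ _).trans e2.symm]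

theorem hornMap_one_surjective (hP : P.IsCrossedModule) (l : Fin 3) :
    Function.Surjective (P.nerve.hornMap 1 l) := by
  apply SimplicialSet.hornMap_surjective
  intro f hf
  have iso : ∀ {s t : C} (α : s ⟶ t), IsIso α := hP.isIso
  have fin3 : ∀ {q : Fin 3 → Prop}, q 0 → q 1 → q 2 → ∀ i, q i := fun h0 h1 h2 i => by
    fin_cases i <;> assumption
  have no : ∀ {m : ℕ} {i : Fin m} {q : Prop}, i ≠ i → q := fun h => absurd rfl h
  obtain ⟨_, _, m₀, e0⟩ := exists_edge (f 0)
  obtain ⟨_, _, m₁, e1⟩ := exists_edge (f 1)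
  obtain ⟨_, _, m₂, e2⟩ := exists_edge (f 2)
  fin_cases l
  · have h : P.nerve.d 1 (f 2) = P.nerve.d 1 (f 1) :=
      hf 1 1 (by omega) (by omega) (by simp) (by simp)
    rw [e1, e2, d_one_edge, d_one_edge] at h
    obtain ⟨rfl, -⟩ := Sigma.mk.inj h
    refine ⟨triangle m₂ 1 (m₁ ≫ inv m₂), fin3 no (fun _ => ?_) (fun _ => ?_)⟩
    · rw [d_one_triangle, e1]
      simp [del_one]
    · rw [d_two_triangle, e2]
  · have h : P.nerve.d 0 (f 2) = P.nerve.d 1 (f 0) :=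
      hf 0 1 (by omega) (by omega) (by simp) (by simp)
    rw [e0, e2, d_zero_edge, d_one_edge] at h
    obtain ⟨rfl, -⟩ := Sigma.mk.inj h
    refine ⟨triangle m₂ 1 m₀, fin3 (fun _ => ?_) no (fun _ => ?_)⟩
    · rw [d_zero_triangle, e0]
    · rw [d_two_triangle, e2]
  · have h : P.nerve.d 0 (f 1) = P.nerve.d 0 (f 0) :=
      hf 0 0 (by omega) (by omega) (by simp) (by simp)
    rw [e0, e1, d_zero_edge, d_zero_edge] at h
    obtain ⟨rfl, -⟩ := Sigma.mk.inj h
    refine ⟨triangle (inv m₀ ≫ m₁) 1 m₀, fin3 (fun _ => ?_) (fun _ => ?_) no⟩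
    · rw [d_zero_triangle, e0]
    · rw [d_one_triangle, e1]
      simp [del_one]

end CrossedMonoid

/-! ### Horns in dimension 1, and the theorem. -/

theorem SimplicialSet.hornMap_zero_surjective (S : SimplicialSet.{w}) (l : Fin 2) :
    Function.Surjective (S.hornMap 0 l) := by
  rintro ⟨x, hx⟩
  obtain ⟨i, hi, h⟩ : ∃ i, i ≠ l ∧ ∀ j, j ≠ l → j = i := by
    fin_cases l
    · exact ⟨1, by decide, by decide⟩
    · exact ⟨0, by decide, by decide⟩
  refine ⟨S.s 0 (x ⟨i, hi⟩), Subtype.ext (funext ?_)⟩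
  rintro ⟨j, hj⟩
  obtain rfl := h j hj
  induction j using Fin.cases with
  | zero => exact S.d_s_self 0 _
  | succ j =>
    obtain rfl := Subsingleton.elim (α := Fin 1) j 0
    exact S.d_s_succ 0 _

theorem mainTheorem4 {C : Type u} [Category.{v} C] (P : CrossedMonoid.{v, u, w} C)
    (hP : P.IsCrossedModule) :
    (∀ M : P.nerve.Boundary 2,
      M ∈ Set.range (P.nerve.boundaryMap 2) ↔ CrossedMonoid.ImageEquation M) ∧
    (∀ j : Fin 4, Function.Surjective (P.nerve.hornMap 2 j)) ∧
    (∀ j : Fin 5, Function.Surjective (P.nerve.hornMap 3 j)) ∧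
    (∀ n : ℕ, 4 ≤ n + 1 → Function.Bijective (P.nerve.boundaryMap n)) ∧
    P.nerve.IsKan := by
  have hE := CrossedMonoid.facesDetermine_nerve hP
  have hF := CrossedMonoid.facesFill_nerve hP
  have h3 := CrossedMonoid.hornMap_two_surjective hP
  have h4 := SimplicialSet.hornMap_three_surjective hF
    (CrossedMonoid.hornMap_two_injective hP) h3
  refine ⟨CrossedMonoid.mem_range_boundaryMap_iff hP, h3, h4, ?_, ?_⟩
  · intro n hn
    obtain ⟨n, rfl⟩ : ∃ k, n = k + 3 := ⟨n - 3, by omega⟩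
    exact ⟨SimplicialSet.boundaryMap_injective hE n, SimplicialSet.boundaryMap_surjective hE hF n⟩
  · intro n l
    match n, l with
    | 0, l => exact SimplicialSet.hornMap_zero_surjective _ l
    | 1, l => exact CrossedMonoid.hornMap_one_surjective hP l
    | 2, l => exact h3 l
    | 3, l => exact h4 l
    -- The horn has dimension `n + 5`, so its missing face has dimension at least 4 and boundaries
    -- can be filled in both dimensions.
    | n + 4, l =>
      exact SimplicialSet.hornMap_surjective_of_boundaryMap
        (SimplicialSet.boundaryMap_surjective hE hF n)
        (SimplicialSet.boundaryMap_surjective hE hF (n + 1)) l
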